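/- Let $\mathcal E$ be a cofibrant $E_\infty$ operad over $\mathbb Z$: an operad in $\mathbb Z$-graded complexes of abelian groups such that $\mathcal E$ is quasi-isomorphic, by an augmentation, to the operad of commutative algebras, each complex $\mathcal E(n)$ consists of projective $\mathbb Z[\Sigma_n]$-modules, and every morphism of operads from $\mathcal E$ to the target of an arity-wise surjective quasi-isomorphism of operads lifts to its source. Let $\mathfrak E$ be the category of $\mathcal E$-algebras ("$E_\infty$ algebras"). An $E_\infty$ algebra $A$ is called cofibrant if every morphism $A\to C$ lifts along every surjective quasi-isomorphism $B\to C$ of $E_\infty$ algebras. For a simplicial set $X$ and a commutative ring $R$ let $C^*(X;R)$ be the complex of normalized cochains of $X$ with coefficients in $R$, made into an $E_\infty$ algebra by an $\mathcal E$-algebra structure which is natural in $X$ and in $R$ (any such natural structure is allowed). For an $E_\infty$ algebra $A$ let $T(A;R)$ be the simplicial set $$T(A;R)_n=\mathfrak E\bigl(A,\,C^*(\Delta[n];R)\bigr)$$ of $E_\infty$ algebra maps, and write $U(A)=T(A;\mathbb Z)$. Let $\mathbb Z^\wedge=\prod_p\mathbb Z_p$ be the product of the $p$-adic integers over all primes $p$,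 and let $\mathbb Q^\wedge=\mathbb Z^\wedge\otimes_{\mathbb Z}\mathbb Q$. **Theorem.** Let $A$ be a cofibrant $E_\infty$ algebra. Then the commutative square of simplicial sets $$\begin{array}{ccc}U(A)&\longrightarrow&T(A;\mathbb Z^\wedge)\\ \downarrow&&\downarrow\\ T(A;\mathbb Q)&\longrightarrow&T(A;\mathbb Q^\wedge)\end{array}$$ induced by the inclusions $\mathbb Z\to\mathbb Z^\wedge$, $\mathbb Z\to\mathbb Q$, $\mathbb Z^\wedge\to\mathbb Q^\wedge$, $\mathbb Q\to\mathbb Q^\wedge$ is homotopy cartesian, i.e., the induced map from $U(A)$ to the homotopy pullback of $T(A;\mathbb Z^\wedge)\to T(A;\mathbb Q^\wedge)$ along $T(A;\mathbb Q)\to T(A;\mathbb Q^\wedge)$ is a weak equivalence. Explicitly: for a replacement of the cospan $T(A;\mathbb Z^\wedge)\to T(A;\mathbb Q^\wedge)\leftarrow T(A;\mathbb Q)$ by a weakly equivalent cospan $X'\to Z'\leftarrow Y'$ of Kan fibrations over a Kan complex $Z'$, the induced map $U(A)\to X'\times_{Z'}Y'$ is a weak equivalence (this does not depend on the choice of the replacement).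 -/

import Mathlib

open CategoryTheory Limits Opposite Simplicial HomotopicalAlgebra
open SSet.modelCategoryQuillen

noncomputable section

/-! ### Differential graded operads over the integers and their algebras -/

/-- Complexes of abelian groups, graded by `ℤ`, with differentials of degree `+1`. -/
abbrev Cplx : Type 1 := CochainComplex (ModuleCat.{0} ℤ) ℤ

/-- The Koszul sign of the rearrangement of `a 0 ⊗ ⋯ ⊗ a (m - 1)` into
`a (σ 0) ⊗ ⋯ ⊗ a (σ (n - 1))` (so `n = m`), where `a i` has degree `q i`. -/
def permSign {n m : ℕ} (σ : Fin n ≃ Fin m) (q : Fin m → ℤ) : ℤˣ :=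
  ∏ j : Fin n, ∏ i : Fin n, if i < j ∧ σ j < σ i then (q (σ i) * q (σ j)).negOnePow else 1

/-- The Koszul sign of the rearrangement of `y 0 ⊗ ⋯ ⊗ y (n - 1) ⊗ z 0 ⊗ ⋯ ⊗ z (n - 1)` into
`y 0 ⊗ z 0 ⊗ ⋯ ⊗ y (n - 1) ⊗ z (n - 1)`, where `y i` has degree `s i` and `z i` has degree `t i`. -/
def shuffleSign {n : ℕ} (s t : Fin n → ℤ) : ℤˣ :=
  ∏ j : Fin n, ∏ i : Fin n, if i < j then (s j * t i).negOnePow else 1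

/-- The degrees `q`, with the `j`-th one raised by `1`. -/
def raise {n : ℕ} (q : Fin n → ℤ) (j : Fin n) : Fin n → ℤ := fun i => if i = j then q i + 1 else q i

/-- The family obtained from `a` by applying the differential to its `j`-th member
and leaving the other members unchanged. -/
def dAt {n : ℕ} (F : Fin n → Cplx) (q : Fin n → ℤ) (j : Fin n) (a : ∀ i, (F i).X (q i)) (i : Fin n) :
    (F i).X (raise q j i) :=
  if h : i = j then ((F i).d (q i) (raise q j i)).hom (a i)
  else ((F i).XIsoOfEq (if_neg h).symm).hom.hom (a i)

lemma degree_dAt {n : ℕ} {p r : ℤ} {q : Fin n → ℤ} (h : p + ∑ i, q i = r) (j : Fin n) :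
    p + ∑ i, raise q j i = r + 1 := by
  have : ∀ i, raise q j i = q i + if i = j then 1 else 0 := fun i => by
    unfold raise; split_ifs <;> simp
  simp [this, Finset.sum_add_distrib, ← h, add_assoc]

lemma degree_d {n : ℕ} {p r : ℤ} {q : Fin n → ℤ} (h : p + ∑ i, q i = r) :
    p + 1 + ∑ i, q i = r + 1 := by
  omega

lemma degree_perm {n m : ℕ} {p r : ℤ} {q : Fin m → ℤ} (h : p + ∑ i, q i = r) (σ : Fin n ≃ Fin m) :
    p + ∑ i, q (σ i) = r := by
  rw [← h, σ.sum_comp q]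

lemma sum_block {n : ℕ} (k : Fin n → ℕ) (c : Fin (∑ j, k j) → ℕ) :
    ∑ j, ∑ i, c (finSigmaFinEquiv ⟨j, i⟩) = ∑ l, c l := by
  rw [← finSigmaFinEquiv.sum_comp c, Fintype.sum_sigma]

/-- A (symmetric, unital) operad in complexes of abelian groups.

`map σ` relabels the inputs of an operation along `σ`; for `n = m` this is the (left) action of the
symmetric group.  `comp k p s r h x y` is the total composition `γ(x; y 0, …, y (n - 1))` of `x` of
arity `n` and degree `p` with `y j` of arity `k j` and degree `s j`; the inputs of the composite are
numbered in lexicographic order. -/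
structure DGOperad where
  obj : ℕ → Cplx
  map {n m : ℕ} (σ : Fin n ≃ Fin m) : obj n ⟶ obj m
  one : (obj 1).X 0
  comp {n : ℕ} (k : Fin n → ℕ) (p : ℤ) (s : Fin n → ℤ) (r : ℤ) (h : p + ∑ j, s j = r) :
    (obj n).X p →ₗ[ℤ] MultilinearMap ℤ (fun j => (obj (k j)).X (s j)) ((obj (∑ j, k j)).X r)
  map_refl (n : ℕ) : map (Equiv.refl (Fin n)) = 𝟙 (obj n)
  map_trans {n m l : ℕ} (σ : Fin n ≃ Fin m) (τ : Fin m ≃ Fin l) :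
    map (σ.trans τ) = map σ ≫ map τ
  d_one : ((obj 1).d 0 1).hom one = 0
  /-- Composition is a chain map. -/
  d_comp {n : ℕ} (k : Fin n → ℕ) (p : ℤ) (s : Fin n → ℤ) (r : ℤ) (h : p + ∑ j, s j = r)
    (x : (obj n).X p) (y : ∀ j, (obj (k j)).X (s j)) :
    ((obj (∑ j, k j)).d r (r + 1)).hom (comp k p s r h x y) =
      comp k (p + 1) s (r + 1) (degree_d h) (((obj n).d p (p + 1)).hom x) y +
      ∑ j, (p + ∑ i ∈ Finset.Iio j, s i).negOnePow •
        comp k p (raise s j) (r + 1) (degree_dAt h j) x (dAt (fun i => obj (k i)) s j y)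
  one_comp (k : ℕ) (s : ℤ) (y : (obj k).X s) :
    comp (fun _ : Fin 1 => k) 0 (fun _ => s) s (by simp) one (fun _ => y) =
      ((map (finCongr (by simp))).f s).hom y
  comp_one (n : ℕ) (p : ℤ) (x : (obj n).X p) :
    comp (fun _ : Fin n => 1) p (fun _ => 0) p (by simp) x (fun _ => one) =
      ((map (finCongr (by simp))).f p).hom x
  /-- Associativity. -/
  comp_comp {n : ℕ} (k : Fin n → ℕ) (c : Fin (∑ j, k j) → ℕ)
    (p : ℤ) (s : Fin n → ℤ) (q : Fin (∑ j, k j) → ℤ) (u : ℤ) (v : Fin n → ℤ) (r : ℤ)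
    (hu : p + ∑ j, s j = u) (hr : u + ∑ l, q l = r)
    (hv : ∀ j, s j + ∑ i, q (finSigmaFinEquiv ⟨j, i⟩) = v j) (hr' : p + ∑ j, v j = r)
    (x : (obj n).X p) (y : ∀ j, (obj (k j)).X (s j)) (z : ∀ l, (obj (c l)).X (q l)) :
    comp c u q r hr (comp k p s u hu x y) z =
      shuffleSign s (fun j => ∑ i, q (finSigmaFinEquiv ⟨j, i⟩)) •
        ((map (finCongr (sum_block k c))).f r).hom
          (comp (fun j => ∑ i, c (finSigmaFinEquiv ⟨j, i⟩)) p v r hr' x fun j =>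
            comp (fun i => c (finSigmaFinEquiv ⟨j, i⟩)) (s j)
              (fun i => q (finSigmaFinEquiv ⟨j, i⟩)) (v j) (hv j) (y j)
              fun i => z (finSigmaFinEquiv ⟨j, i⟩))
  /-- Equivariance in the outer variable. -/
  map_comp {n m : ℕ} (σ : Fin n ≃ Fin m) (k : Fin m → ℕ) (p : ℤ) (s : Fin m → ℤ) (r : ℤ)
    (h : p + ∑ j, s j = r) (x : (obj n).X p) (y : ∀ j, (obj (k j)).X (s j)) :
    comp k p s r h (((map σ).f p).hom x) y =
      permSign σ s •
        ((map (finSigmaFinEquiv.symm.trans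
            ((Equiv.sigmaCongrLeft (β := fun j => Fin (k j)) σ).trans finSigmaFinEquiv))).f r).hom
          (comp (fun j => k (σ j)) p (fun j => s (σ j)) r (degree_perm h σ) x (fun j => y (σ j)))
  /-- Equivariance in the inner variables. -/
  comp_map {n : ℕ} (k l : Fin n → ℕ) (σ : ∀ j, Fin (k j) ≃ Fin (l j)) (p : ℤ) (s : Fin n → ℤ)
    (r : ℤ) (h : p + ∑ j, s j = r) (x : (obj n).X p) (y : ∀ j, (obj (k j)).X (s j)) :
    comp l p s r h x (fun j => ((map (σ j)).f (s j)).hom (y j)) =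
      ((map (finSigmaFinEquiv.symm.trans
          ((Equiv.sigmaCongrRight σ).trans finSigmaFinEquiv))).f r).hom
        (comp k p s r h x y)

namespace DGOperad

/-- Morphisms of operads. -/
@[ext]
structure Hom (P Q : DGOperad) where
  app (n : ℕ) : P.obj n ⟶ Q.obj n
  map_app {n m : ℕ} (σ : Fin n ≃ Fin m) : P.map σ ≫ app m = app n ≫ Q.map σ
  app_one : ((app 1).f 0).hom P.one = Q.one
  app_comp {n : ℕ} (k : Fin n → ℕ) (p : ℤ) (s : Fin n → ℤ) (r : ℤ) (h : p + ∑ j, s j = r)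
    (x : (P.obj n).X p) (y : ∀ j, (P.obj (k j)).X (s j)) :
    ((app (∑ j, k j)).f r).hom (P.comp k p s r h x y) =
      Q.comp k p s r h (((app n).f p).hom x) (fun j => ((app (k j)).f (s j)).hom (y j))

instance : Category DGOperad where
  Hom := Hom
  id P :=
    { app := fun n => 𝟙 (P.obj n)
      map_app := by simp
      app_one := by simp
      app_comp := by simp }
  comp {P Q S} f g :=
    { app := fun n => f.app n ≫ g.app n
      map_app := fun σ => by rw [← Category.assoc, f.map_app, Category.assoc, g.map_app,
        Category.assoc]
      app_one := by simp [f.app_one, g.app_one]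
      app_comp := by simp [f.app_comp, g.app_comp] }

/-- An operad is cofibrant if its unique morphism from the initial operad has the left lifting
property with respect to the acyclic fibrations, that is, to the morphisms of operads which are
surjective and quasi-isomorphisms in each arity. -/
def IsCofibrant (E : DGOperad) : Prop :=
  ∀ (P Q : DGOperad) (π : P ⟶ Q), (∀ n i, Function.Surjective ((π.app n).f i).hom) →
    (∀ n, QuasiIso (π.app n)) → ∀ f : E ⟶ Q, ∃ g : E ⟶ P, g ≫ π = f

/-- The action of the symmetric group on the operations of a given arity and degree. -/
def permRep (E : DGOperad) (n : ℕ) (p : ℤ) :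
    Representation ℤ (Equiv.Perm (Fin n)) ((E.obj n).X p) where
  toFun σ := ((E.map σ).f p).hom
  map_one' := by
    change ((E.map (Equiv.refl (Fin n))).f p).hom = 1
    rw [E.map_refl]
    rfl
  map_mul' σ τ := by
    change ((E.map (Equiv.trans τ σ)).f p).hom = _
    rw [E.map_trans]
    rfl

/-- A morphism from `E` to the operad of commutative algebras (which is `ℤ` in degree `0`, with the
trivial action, in each arity) that is a quasi-isomorphism in each arity. -/
structure AcyclicAugmentation (E : DGOperad) where
  ε (n : ℕ) : (E.obj n).X 0 →ₗ[ℤ] ℤ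
  ε_d (n : ℕ) (x : (E.obj n).X (-1)) : ε n (((E.obj n).d (-1) 0).hom x) = 0
  ε_map {n m : ℕ} (σ : Fin n ≃ Fin m) (x : (E.obj n).X 0) : ε m (((E.map σ).f 0).hom x) = ε n x
  ε_one : ε 1 E.one = 1
  ε_comp {n : ℕ} (k : Fin n → ℕ) (x : (E.obj n).X 0) (y : ∀ j, (E.obj (k j)).X 0) :
    ε (∑ j, k j) (E.comp k 0 (fun _ => 0) 0 (by simp) x y) = ε n x * ∏ j, ε (k j) (y j)
  exactAt (n : ℕ) (i : ℤ) (hi : i ≠ 0) : (E.obj n).ExactAt i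
  exists_cocycle (n : ℕ) : ∃ x, ((E.obj n).d 0 1).hom x = 0 ∧ ε n x = 1
  exists_boundary (n : ℕ) (x : (E.obj n).X 0) (hx : ((E.obj n).d 0 1).hom x = 0)
    (hε : ε n x = 0) : ∃ y, ((E.obj n).d (-1) 0).hom y = x

/-- An `E∞` operad: it is quasi-isomorphic to the operad of commutative algebras by an augmentation,
and its operations of arity `n` form a complex of projective `ℤ[Σₙ]`-modules. -/
structure IsEInfinity (E : DGOperad) : Prop where
  augmentation : Nonempty E.AcyclicAugmentation
  projective (n : ℕ) (p : ℤ) :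
    Module.Projective (MonoidAlgebra ℤ (Equiv.Perm (Fin n))) (E.permRep n p).asModule

/-- The structure of an `E`-algebra on a complex: `act p q r h x a` is the value of the operation
`x` of degree `p` on the elements `a j` of degree `q j`. -/
structure AlgStruct (E : DGOperad) (A : Cplx) where
  act {n : ℕ} (p : ℤ) (q : Fin n → ℤ) (r : ℤ) (h : p + ∑ j, q j = r) :
    (E.obj n).X p →ₗ[ℤ] MultilinearMap ℤ (fun j => A.X (q j)) (A.X r)
  d_act {n : ℕ} (p : ℤ) (q : Fin n → ℤ) (r : ℤ) (h : p + ∑ j, q j = r)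
    (x : (E.obj n).X p) (a : ∀ j, A.X (q j)) :
    (A.d r (r + 1)).hom (act p q r h x a) =
      act (p + 1) q (r + 1) (degree_d h) (((E.obj n).d p (p + 1)).hom x) a +
      ∑ j, (p + ∑ i ∈ Finset.Iio j, q i).negOnePow •
        act p (raise q j) (r + 1) (degree_dAt h j) x (dAt (fun _ => A) q j a)
  one_act (q : ℤ) (a : A.X q) :
    act (n := 1) 0 (fun _ => q) q (by simp) E.one (fun _ => a) = a
  comp_act {n : ℕ} (k : Fin n → ℕ)
    (p : ℤ) (s : Fin n → ℤ) (q : Fin (∑ j, k j) → ℤ) (u : ℤ) (v : Fin n → ℤ) (r : ℤ)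
    (hu : p + ∑ j, s j = u) (hr : u + ∑ l, q l = r)
    (hv : ∀ j, s j + ∑ i, q (finSigmaFinEquiv ⟨j, i⟩) = v j) (hr' : p + ∑ j, v j = r)
    (x : (E.obj n).X p) (y : ∀ j, (E.obj (k j)).X (s j)) (a : ∀ l, A.X (q l)) :
    act u q r hr (E.comp k p s u hu x y) a =
      shuffleSign s (fun j => ∑ i, q (finSigmaFinEquiv ⟨j, i⟩)) •
        act p v r hr' x fun j =>
          act (s j) (fun i => q (finSigmaFinEquiv ⟨j, i⟩)) (v j) (hv j) (y j)
            fun i => a (finSigmaFinEquiv ⟨j, i⟩)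
  map_act {n m : ℕ} (σ : Fin n ≃ Fin m) (p : ℤ) (q : Fin m → ℤ) (r : ℤ) (h : p + ∑ j, q j = r)
    (x : (E.obj n).X p) (a : ∀ j, A.X (q j)) :
    act p q r h (((E.map σ).f p).hom x) a =
      permSign σ q • act p (fun j => q (σ j)) r (degree_perm h σ) x (fun j => a (σ j))

/-- A chain map is a morphism of `E`-algebras if it commutes with all operations. -/
def IsAlgHom {E : DGOperad} {A B : Cplx} (α : E.AlgStruct A) (β : E.AlgStruct B) (f : A ⟶ B) :
    Prop :=
  ∀ {n : ℕ} (p : ℤ) (q : Fin n → ℤ) (r : ℤ) (h : p + ∑ j, q j = r)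
    (x : (E.obj n).X p) (a : ∀ j, A.X (q j)),
    (f.f r).hom (α.act p q r h x a) = β.act p q r h x (fun j => (f.f (q j)).hom (a j))

/-- The objects of the category of `E`-algebras. -/
structure Alg (E : DGOperad) where
  cplx : Cplx
  str : E.AlgStruct cplx

/-- Morphisms of `E`-algebras. -/
@[ext]
structure Alg.Hom {E : DGOperad} (A B : E.Alg) where
  hom : A.cplx ⟶ B.cplx
  isAlgHom : IsAlgHom A.str B.str hom

instance (E : DGOperad) : Category E.Alg where
  Hom := Alg.Hom
  id A := ⟨𝟙 A.cplx, fun p q r h x a => by simp⟩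
  comp f g := ⟨f.hom ≫ g.hom, fun p q r h x a => by
    simp [f.isAlgHom p q r h x a, g.isAlgHom p q r h]⟩

/-- An `E`-algebra is cofibrant if its unique morphism from the initial `E`-algebra has the left
lifting property with respect to the acyclic fibrations, that is, to the morphisms of `E`-algebras
which are surjective quasi-isomorphisms. -/
def Alg.IsCofibrant {E : DGOperad} (A : E.Alg) : Prop :=
  ∀ (B C : E.Alg) (π : B ⟶ C), (∀ i, Function.Surjective (π.hom.f i).hom) →
    QuasiIso π.hom → ∀ f : A ⟶ C, ∃ g : A ⟶ B, g ≫ π = f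

end DGOperad

/-! ### Normalized cochains -/

/-- The functions to `R` on the `n`-simplices of `X`, for `n = q` (so there is only one if `q < 0`). -/
abbrev SimplexFun (X : SSet.{0}) (R : Type) (q : ℤ) : Type :=
  ∀ n : {n : ℕ // (n : ℤ) = q}, X _⦋n.1⦌ → R

/-- The normalized cochains of degree `q` on `X` with coefficients in `R`: the functions to `R` on
the `q`-simplices that vanish on the degenerate simplices. -/
def normCochains (X : SSet.{0}) (R : Type) [CommRing R] (q : ℤ) :
    Submodule ℤ (SimplexFun X R q) where
  carrier := {f | ∀ n (x : X _⦋n.1⦌), x ∈ X.degenerate n.1 → f n x = 0}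
  add_mem' hf hg n x hx := by simp [hf n x hx, hg n x hx]
  zero_mem' n x hx := rfl
  smul_mem' c f hf n x hx := by simp [hf n x hx]

namespace normCochains

/-- The coboundary: the alternating sum of the values of `f` on the faces of a simplex. -/
def dFun {X : SSet.{0}} {R : Type} [CommRing R] {i j : ℤ} (hij : i + 1 = j)
    (f : SimplexFun X R i) : SimplexFun X R j :=
  fun n => match n with
    | ⟨0, _⟩ => fun _ => 0
    | ⟨n + 1, h⟩ => fun x =>
        ∑ k : Fin (n + 2), (-1 : ℤ) ^ (k : ℕ) • f ⟨n, by omega⟩ (X.δ k x)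

lemma dFun_mem {X : SSet.{0}} {R : Type} [CommRing R] {i j : ℤ} (hij : i + 1 = j)
    (f : SimplexFun X R i) (hf : f ∈ normCochains X R i) :
    dFun hij f ∈ normCochains X R j := by
  rintro ⟨n, h⟩ x hx
  obtain _ | n := n
  · rfl
  rw [SSet.degenerate_eq_iUnion_range_σ, Set.mem_iUnion] at hx
  obtain ⟨a, y, rfl⟩ := hx
  change ∑ k : Fin (n + 2), (-1 : ℤ) ^ (k : ℕ) • f ⟨n, by omega⟩ (X.δ k (X.σ a y)) = 0
  have key (k : Fin (n + 2)) (h₁ : k ≠ a.castSucc) (h₂ : k ≠ a.succ) :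
      f ⟨n, by omega⟩ (X.δ k (X.σ a y)) = 0 := by
    apply hf
    obtain _ | n := n
    · exfalso
      fin_cases a
      fin_cases k
      · exact h₁ rfl
      · exact h₂ rfl
    · obtain h₃ | h₃ := lt_or_gt_of_ne h₁
      · obtain ⟨a, rfl⟩ := Fin.exists_succ_eq.2 (show a ≠ 0 by rintro rfl; simp at h₃)
        obtain ⟨k, rfl⟩ := Fin.exists_castSucc_eq.2
          (show k ≠ Fin.last _ from (h₃.trans_le (Fin.le_last _)).ne)
        have h₄ : k ≤ a.castSucc := by
          simp only [Fin.lt_def, Fin.le_def, Fin.val_castSucc, Fin.val_succ] at h₃ ⊢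
          omega
        exact (congrArg (· ∈ X.degenerate (n + 1)) (SSet.δ_comp_σ_of_le_apply h₄ y)).mpr
          (X.σ_mem_degenerate _ _)
      · have h₄ : a.succ < k := by
          simp only [Fin.lt_def, Fin.ext_iff, Fin.val_castSucc, Fin.val_succ, ne_eq] at h₂ h₃ ⊢
          omega
        exact (congrArg (· ∈ X.degenerate (n + 1)) (SSet.δ_comp_σ_of_gt'_apply h₄ y)).mpr
          (X.σ_mem_degenerate _ _)
  rw [Fintype.sum_eq_add a.castSucc a.succ (by simp [Fin.ext_iff])
    (fun k hk => by rw [key k hk.1 hk.2, smul_zero])]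
  rw [SSet.δ_comp_σ_self_apply, SSet.δ_comp_σ_succ_apply]
  simp [pow_succ]

lemma dFun_dFun {X : SSet.{0}} {R : Type} [CommRing R] {i j k : ℤ} (hij : i + 1 = j)
    (hjk : j + 1 = k) (f : SimplexFun X R i) :
    dFun hjk (dFun hij f) = 0 := by
  funext n x
  obtain ⟨_ | _ | n, h⟩ := n
  · rfl
  · change ∑ l : Fin 2, (-1 : ℤ) ^ (l : ℕ) • (0 : R) = 0
    simp
  change ∑ b : Fin (n + 3), (-1 : ℤ) ^ (b : ℕ) • ∑ a : Fin (n + 2), (-1 : ℤ) ^ (a : ℕ) •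
    f ⟨n, by omega⟩ (X.δ a (X.δ b x)) = 0
  simp only [Finset.smul_sum, smul_smul]
  rw [Finset.sum_comm, ← Finset.sum_product', Finset.univ_product_univ]
  let S : Finset (Fin (n + 2) × Fin (n + 3)) := {ab | (ab.2 : ℕ) ≤ (ab.1 : ℕ)}
  rw [← Finset.sum_add_sum_compl S, ← eq_neg_iff_add_eq_zero, ← Finset.sum_neg_distrib]
  let φ : ∀ ab : Fin (n + 2) × Fin (n + 3), ab ∈ S → Fin (n + 2) × Fin (n + 3) := fun ab hab =>
    (Fin.castLT ab.2 (lt_of_le_of_lt (Finset.mem_filter.mp hab).right (Fin.is_lt ab.1)), ab.1.succ)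
  apply Finset.sum_bij φ
  · intro ab hab
    simp_rw [S, φ, Finset.compl_filter, Finset.mem_filter_univ, Fin.val_succ,
      Fin.val_castLT] at hab ⊢
    omega
  · rintro ⟨a, b⟩ hab ⟨a', b'⟩ hab' h
    simp only [φ, Prod.mk.injEq, Fin.ext_iff, Fin.val_castLT, Fin.val_succ] at h ⊢
    omega
  · rintro ⟨a', b'⟩ hab'
    simp_rw [S, Finset.compl_filter, Finset.mem_filter_univ, not_le] at hab'
    refine ⟨(⟨b' - 1, by omega⟩, a'.castSucc), ?_, ?_⟩
    · simp only [S, Finset.mem_filter_univ, Fin.val_castSucc]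
      omega
    · simp only [φ, Prod.mk.injEq, Fin.ext_iff, Fin.val_castLT, Fin.val_succ, Fin.val_castSucc,
        true_and]
      omega
  · rintro ⟨a, b⟩ hab
    have hab' : b ≤ a.castSucc := by simpa [S, Fin.le_def] using hab
    simp only [φ, Fin.val_succ, Fin.val_castLT]
    rw [← neg_smul]
    congr 1
    · ring
    · exact congrArg _ (SSet.δ_comp_δ''_apply hab' x).symm

/-- The differential of the complex of normalized cochains. -/
def d (X : SSet.{0}) (R : Type) [CommRing R] {i j : ℤ} (hij : i + 1 = j) :
    normCochains X R i →ₗ[ℤ] normCochains X R j where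
  toFun f := ⟨dFun hij f.1, dFun_mem hij f.1 f.2⟩
  map_add' f g := by
    ext ⟨_ | n, h⟩ x
    · simp [dFun]
    · simp [dFun, Finset.sum_add_distrib]
  map_smul' c f := by
    ext ⟨_ | n, h⟩ x
    · simp [dFun]
    · simp [dFun, Finset.mul_sum, mul_left_comm]

/-- Restriction along a morphism of simplicial sets and change of coefficients. -/
def map {X Y : SSet.{0}} {R S : Type} [CommRing R] [CommRing S] (g : X ⟶ Y) (φ : R →+* S) (q : ℤ) :
    normCochains Y R q →ₗ[ℤ] normCochains X S q where
  toFun f := ⟨fun n x => φ (f.1 n (g.app _ x)), fun n x hx => by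
    change φ (f.1 n (g.app _ x)) = 0
    rw [f.2 n _ (SSet.degenerate_app_apply hx g), map_zero]⟩
  map_add' f f' := by ext; simp
  map_smul' c f := by ext; simp

end normCochains

/-- The complex `C^*(X; R)` of normalized cochains. -/
def cochainCplx (X : SSet.{0}) (R : Type) [CommRing R] : Cplx where
  X q := ModuleCat.of ℤ (normCochains X R q)
  d i j := if hij : i + 1 = j then ModuleCat.ofHom (normCochains.d X R hij) else 0
  shape i j hij := dif_neg hij
  d_comp_d' i j k hij hjk := by
    obtain rfl : i + 1 = j := hij
    obtain rfl : i + 1 + 1 = k := hjk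
    ext f
    simp only [dif_pos]
    exact congrFun (congrFun (normCochains.dFun_dFun rfl rfl (Subtype.val f)) _) _

/-- The functoriality of the complex of normalized cochains. -/
def cochainMap {X Y : SSet.{0}} {R S : Type} [CommRing R] [CommRing S] (g : X ⟶ Y) (φ : R →+* S) :
    cochainCplx Y R ⟶ cochainCplx X S where
  f q := ModuleCat.ofHom (normCochains.map g φ q)
  comm' i j hij := by
    obtain rfl : i + 1 = j := hij
    ext f
    refine Subtype.ext (funext fun n => funext fun x => ?_)
    obtain ⟨_ | n, h⟩ := n
    · simp only [cochainCplx, dif_pos]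
      exact (map_zero φ).symm
    · simp only [cochainCplx, dif_pos]
      change ∑ k : Fin (n + 2), (-1 : ℤ) ^ (k : ℕ) • φ (Subtype.val f ⟨n, _⟩ (g.app _ (X.δ k x))) =
        φ (∑ k : Fin (n + 2), (-1 : ℤ) ^ (k : ℕ) • Subtype.val f ⟨n, _⟩ (Y.δ k (g.app _ x)))
      simp only [map_sum, map_zsmul]
      refine Finset.sum_congr rfl fun k _ => ?_
      rw [SSet.δ_naturality_apply]

/-- A natural structure of `E`-algebra on the normalized cochains `C^*(X; R)`, where `X` runs
through the simplicial sets and `R` through the commutative rings; in other words, a lift of the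
functor `C^*(-; -)` from complexes to `E`-algebras. -/
structure CochainAction (E : DGOperad) where
  str (X : SSet.{0}) (R : Type) [CommRing R] : E.AlgStruct (cochainCplx X R)
  natural {X Y : SSet.{0}} {R S : Type} [CommRing R] [CommRing S] (g : X ⟶ Y) (φ : R →+* S) :
    DGOperad.IsAlgHom (str Y R) (str X S) (cochainMap g φ)

namespace CochainAction

variable {E : DGOperad} (θ : CochainAction E)

/-- The `E`-algebra `C^*(X; R)`, as a functor of the commutative ring `R` and (contravariantly) of
the simplicial set `X`. -/
def cochainAlg : CommRingCat.{0} ⥤ SSet.{0}ᵒᵖ ⥤ E.Alg where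
  obj R :=
    { obj := fun X => ⟨cochainCplx X.unop R, θ.str X.unop R⟩
      map := fun g => ⟨cochainMap g.unop (RingHom.id R), θ.natural _ _⟩
      map_id := fun _ => rfl
      map_comp := fun _ _ => rfl }
  map φ :=
    { app := fun X => ⟨cochainMap (𝟙 X.unop) φ.hom, θ.natural _ _⟩
      naturality := fun _ _ _ => rfl }
  map_id _ := rfl
  map_comp _ _ := rfl

/-- The simplicial set `T(A; R)` of morphisms of `E`-algebras from `A` to `C^*(Δ[•]; R)`,
as a functor of the commutative ring `R`. -/
def T (A : E.Alg) : CommRingCat.{0} ⥤ SSet.{0} :=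
  θ.cochainAlg ⋙ (Functor.whiskeringLeft _ _ _).obj SSet.stdSimplex.op ⋙
    (Functor.whiskeringRight _ _ _).obj (coyoneda.obj (op A))

end CochainAction

/-! ### The arithmetic square of rings -/

instance (p : Nat.Primes) : Fact (p : ℕ).Prime := ⟨p.2⟩

/-- The finite completion of the integers: the product of the `p`-adic integers over all primes. -/
abbrev ZHat : Type := ∀ p : Nat.Primes, ℤ_[p]

open scoped TensorProduct in
/-- The ring `ZHat ⊗ ℚ`. -/
abbrev QHat : Type := ZHat ⊗[ℤ] ℚ

/-- The inclusion of `ZHat` in `QHat`. -/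
def zHatToQHat : CommRingCat.of ZHat ⟶ CommRingCat.of QHat :=
  CommRingCat.ofHom (Algebra.TensorProduct.includeLeftRingHom)

/-- The inclusion of `ℚ` in `QHat`. -/
def ratToQHat : CommRingCat.of ℚ ⟶ CommRingCat.of QHat :=
  CommRingCat.ofHom (Algebra.TensorProduct.includeRight (R := ℤ) (A := ZHat) (B := ℚ)).toRingHom

/-- The inclusion of `ℤ` in `ZHat`. -/
def intToZHat : CommRingCat.of ℤ ⟶ CommRingCat.of ZHat :=
  CommRingCat.ofHom (Int.castRingHom ZHat)

/-- The inclusion of `ℤ` in `ℚ`. -/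
def intToRat : CommRingCat.of ℤ ⟶ CommRingCat.of ℚ :=
  CommRingCat.ofHom (Int.castRingHom ℚ)

/-! ### Homotopy cartesian squares of simplicial sets -/

/-- The set of homotopy classes of morphisms from `X` to `K` (this is used for Kan complexes `K`,
where simplicial homotopy is an equivalence relation). -/
def HomotopyClasses (X K : SSet.{0}) : Type :=
  Quot fun f g : X ⟶ K => Nonempty (SSet.Homotopy f g)

/-- The map induced on homotopy classes by precomposition. -/
def HomotopyClasses.precomp {X Y : SSet.{0}} (f : X ⟶ Y) (K : SSet.{0}) :
    HomotopyClasses Y K → HomotopyClasses X K :=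
  Quot.map (fun g => f ≫ g) fun _ _ ⟨H⟩ =>
    ⟨SSet.RelativeMorphism.Homotopy.precomp H (SSet.RelativeMorphism.botEquiv.symm f)
      (SSet.Subcomplex.isInitialBot.hom_ext _ _)⟩

/-- A morphism of simplicial sets is a weak equivalence if it induces a bijection on homotopy
classes of morphisms to each Kan complex. -/
def IsWeakEquivalence {X Y : SSet.{0}} (f : X ⟶ Y) : Prop :=
  ∀ (K : SSet.{0}) [SSet.KanComplex K], Function.Bijective (HomotopyClasses.precomp f K)

/-- The commutative square with sides `f : W ⟶ X`, `g : W ⟶ Y`, `h : X ⟶ Z`, `k : Y ⟶ Z` is homotopy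
cartesian: the cospan `X ⟶ Z ⟵ Y` can be replaced by a weakly equivalent cospan of Kan fibrations
`X' ⟶ Z' ⟵ Y'` over a Kan complex `Z'` such that the induced morphism from `W` to the pullback
of `X'` and `Y'` over `Z'` is a weak equivalence. -/
def IsHomotopyCartesian {W X Y Z : SSet.{0}} (f : W ⟶ X) (g : W ⟶ Y) (h : X ⟶ Z) (k : Y ⟶ Z) :
    Prop :=
  ∃ (w : f ≫ h = g ≫ k) (X' Y' Z' : SSet.{0}) (x : X ⟶ X') (y : Y ⟶ Y') (z : Z ⟶ Z')
    (p : X' ⟶ Z') (q : Y' ⟶ Z') (hp : x ≫ p = h ≫ z) (hq : y ≫ q = k ≫ z),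
    IsWeakEquivalence x ∧ IsWeakEquivalence y ∧ IsWeakEquivalence z ∧
    SSet.KanComplex Z' ∧ Fibration p ∧ Fibration q ∧
    IsWeakEquivalence (pullback.lift (f ≫ x) (g ≫ y)
      (by rw [Category.assoc, Category.assoc, hp, hq, reassoc_of% w]) : W ⟶ pullback p q)

end

/-! Write S = `QHat`, and let P and Q be the images in S of `ZHat` and ℚ. The arithmetic input is
that P + Q = S and P ∩ Q = ℤ. The other inputs are cofibrancy of A and naturality of the operations
on cochains in the space and in the ring.

The homotopy pullback is made concrete by letting coefficients vary over an auxiliary simplicial set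
K. A coefficient system ρ assigns to each simplex of K a subring of S, smaller on faces. The
`mapping` space of (K, ρ) has as n-simplices the algebra maps from A to the cochains on Δ[n] × K
whose value at (s, k) lies in ρ(k). Such cochains form a subalgebra: the value of an operation at a
simplex y can be computed after restriction to that simplex, where all arguments have coefficients
in the subring of y, and naturality in space and ring applies (`act_mem_coeffSubmodule`).

Take K = Δ[1] with P at the vertex 0 and S elsewhere. Contracting K to 0 shows that this models T(A;
P), and evaluation at 1 is a path fibration onto a model of T(A; S). The same works for Q. The
pullback of the two path fibrations consists of maps on two edges of the square Δ[1] × Δ[1] that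
meet at (1, 1). On the whole square use the intersection of the two systems: it is P ∩ Q = ℤ at (0,
0), and contraction to this vertex shows that it models T(A; ℤ). It remains to see that restriction
from the square to the two edges is a weak equivalence; in fact it lifts against all monomorphisms.

Every lifting problem is an extension problem for algebra maps from A to cochains, from a subcomplex
B to Y (`exists_extension`). Restriction of cochains from Y to B is surjective, and it is a
quasi-isomorphism when the cochains relative to B with the given coefficients are acyclic; then
cofibrancy of A applies. So all rests on acyclicity: for horns (`acyclic_horn`), for a cylinder
relative to one end (`acyclic_cylinder`), for a cylinder whose coefficients shrink at the other end
(`acyclic_path`), and for the square (`acyclic_square`). The last one is a Mayer–Vietoris argument,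
Q/(P ∩ Q) = S/P, and is where P + Q = S enters. -/

noncomputable section

/-- A homomorphism of abelian groups is linear for any structures of modules over the integers. -/
def addMonoidHomToLinearMap {M N : Type*} [AddCommGroup M] [Module ℤ M] [AddCommGroup N]
    [Module ℤ N] (f : M →+ N) : M →ₗ[ℤ] N where
  toFun := f
  map_add' := map_add f
  map_smul' c x := by simpa using map_intCast_smul f ℤ ℤ c x

section

attribute [local instance 10] AddCommGroup.toIntModule

/-! ### Subalgebras of algebras over an operad -/

lemma map_dAt {n : ℕ} {F G : Fin n → Cplx} (φ : ∀ i, F i ⟶ G i) (q : Fin n → ℤ) (j : Fin n)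
    (a : ∀ i, (F i).X (q i)) (i : Fin n) :
    ((φ i).f (raise q j i)).hom (dAt F q j a i) = dAt G q j (fun i => ((φ i).f (q i)).hom (a i)) i := by
  by_cases h : i = j
  · have hF : dAt F q j a i = ((F i).d (q i) (raise q j i)).hom (a i) := dif_pos h
    have hG : dAt G q j (fun i => ((φ i).f (q i)).hom (a i)) i =
        ((G i).d (q i) (raise q j i)).hom (((φ i).f (q i)).hom (a i)) := dif_pos h
    rw [hF, hG]
    exact (ConcreteCategory.congr_hom ((φ i).comm (q i) (raise q j i)) (a i)).symm
  · have hr : q i = raise q j i := (if_neg h : raise q j i = q i).symm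
    have hF : dAt F q j a i = ((F i).XIsoOfEq hr).hom.hom (a i) := dif_neg h
    have hG : dAt G q j (fun i => ((φ i).f (q i)).hom (a i)) i =
        ((G i).XIsoOfEq hr).hom.hom (((φ i).f (q i)).hom (a i)) := dif_neg h
    rw [hF, hG]
    exact ConcreteCategory.congr_hom (HomologicalComplex.XIsoOfEq_hom_naturality (φ i) hr).symm
      (a i)

/-- The subcomplex given by submodules which are stable under the differential. -/
def subCplx (B : Cplx) (N : ∀ q, Submodule ℤ (B.X q))
    (hd : ∀ i j, ∀ b ∈ N i, (B.d i j).hom b ∈ N j) : Cplx where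
  X q := ModuleCat.of ℤ (N q)
  d i j := ModuleCat.ofHom ((B.d i j).hom.restrict (hd i j))
  shape i j hij := ModuleCat.hom_ext (LinearMap.ext fun b => Subtype.ext
    (ConcreteCategory.congr_hom (B.shape i j hij) b.1))
  d_comp_d' i j k _ _ := ModuleCat.hom_ext (LinearMap.ext fun b => Subtype.ext
    (ConcreteCategory.congr_hom (B.d_comp_d i j k) b.1))

/-- The inclusion of a subcomplex. -/
def subCplxι (B : Cplx) (N : ∀ q, Submodule ℤ (B.X q))
    (hd : ∀ i j, ∀ b ∈ N i, (B.d i j).hom b ∈ N j) : subCplx B N hd ⟶ B where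
  f q := ModuleCat.ofHom (N q).subtype
  comm' _ _ _ := rfl

namespace DGOperad

variable {E : DGOperad}

/-- The operations of an algebra, restricted to submodules which are stable under them. -/
def AlgStruct.restrictAct {B : Cplx} (β : E.AlgStruct B) (N : ∀ q, Submodule ℤ (B.X q))
    (hN : ∀ {n : ℕ} (p : ℤ) (q : Fin n → ℤ) (r : ℤ) (h : p + ∑ j, q j = r) (x : (E.obj n).X p)
      (a : ∀ j, B.X (q j)), (∀ j, a j ∈ N (q j)) → β.act p q r h x a ∈ N r)
    {n : ℕ} (p : ℤ) (q : Fin n → ℤ) (r : ℤ) (h : p + ∑ j, q j = r) :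
    (E.obj n).X p →+ MultilinearMap ℤ (fun j => N (q j)) (N r) where
  toFun x := ((β.act p q r h x).compLinearMap fun j => (N (q j)).subtype).codRestrict (N r)
    fun a => hN p q r h x _ fun j => (a j).2
  map_zero' := MultilinearMap.ext fun _ => Subtype.ext
    (congrFun (congrArg DFunLike.coe (map_zero (β.act p q r h))) _)
  map_add' x y := MultilinearMap.ext fun _ => Subtype.ext
    (congrFun (congrArg DFunLike.coe (map_add (β.act p q r h) x y)) _)

/-- The algebra structure on a subcomplex which is stable under all operations. -/
def AlgStruct.restrict {B : Cplx} (β : E.AlgStruct B) (N : ∀ q, Submodule ℤ (B.X q))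
    (hd : ∀ i j, ∀ b ∈ N i, (B.d i j).hom b ∈ N j)
    (hN : ∀ {n : ℕ} (p : ℤ) (q : Fin n → ℤ) (r : ℤ) (h : p + ∑ j, q j = r) (x : (E.obj n).X p)
      (a : ∀ j, B.X (q j)), (∀ j, a j ∈ N (q j)) → β.act p q r h x a ∈ N r) :
    E.AlgStruct (subCplx B N hd) where
  act p q r h := @addMonoidHomToLinearMap _ _ _ _ _ (AddCommGroup.toIntModule _)
    (β.restrictAct N hN p q r h)
  d_act {n} p q r h x a := by
    let ι := ((subCplxι B N hd).f (r + 1)).hom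
    have hι : Function.Injective ι := Subtype.val_injective
    apply hι
    rw [map_add, map_sum]
    refine (β.d_act p q r h x fun j => (a j).1).trans (congrArg₂ (· + ·) rfl ?_)
    refine Finset.sum_congr rfl fun j _ => ?_
    refine congrArg _ (congrArg _ (funext fun i => ?_))
    exact (map_dAt (fun _ => subCplxι B N hd) q j a i).symm
  one_act q a := Subtype.ext (β.one_act q a.1)
  comp_act k p s q u v r hu hr hv hr' x y a :=
    Subtype.ext (β.comp_act k p s q u v r hu hr hv hr' x y fun l => (a l).1)
  map_act σ p q r h x a := Subtype.ext (β.map_act σ p q r h x fun l => (a l).1)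

end DGOperad

end

/-! ### A criterion for quasi-isomorphisms -/

/-- A surjective morphism of complexes with acyclic kernel is a quasi-isomorphism. -/
lemma quasiIso_of_surjective {B C : Cplx} (π : B ⟶ C)
    (hπ : ∀ i, Function.Surjective (π.f i).hom)
    (hk : ∀ i j k, i + 1 = j → j + 1 = k → ∀ b : B.X j, (π.f j).hom b = 0 → (B.d j k).hom b = 0 →
      ∃ a : B.X i, (π.f i).hom a = 0 ∧ (B.d i j).hom a = b) : QuasiIso π := by
  let S : ShortComplex Cplx := ShortComplex.mk (kernel.ι π) π (kernel.condition π)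
  have : Epi π := by
    have : ∀ i, Epi (π.f i) := fun i => (ModuleCat.epi_iff_surjective _).2 (hπ i)
    exact HomologicalComplex.epi_of_epi_f π this
  have hS : S.ShortExact := { exact := ShortComplex.exact_kernel π }
  have hex (j : ℤ) : (S.map (HomologicalComplex.eval _ _ j)).ShortExact :=
    hS.map_of_exact (HomologicalComplex.eval _ _ j)
  -- The hypothesis `hk` is acyclicity of the kernel, stated with elements of `B`. The long exact
  -- homology sequence then makes the map on homology both mono and epi.
  have hacyc : S.X₁.Acyclic := by
    intro j
    rw [HomologicalComplex.exactAt_iff' _ (j - 1) j (j + 1) (by simp) (by simp),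
      ShortComplex.moduleCat_exact_iff]
    intro x hx
    have hx0 : (π.f j).hom ((S.f.f j).hom x) = 0 :=
      ConcreteCategory.congr_hom (S.map (HomologicalComplex.eval _ _ j)).zero x
    obtain ⟨a, ha, hab⟩ := hk (j - 1) j (j + 1) (by omega) rfl ((S.f.f j).hom x) hx0 (by
      refine (ConcreteCategory.congr_hom (S.f.comm j (j + 1)) x).trans ?_
      exact (congrArg (S.f.f (j + 1)).hom hx).trans (map_zero _))
    obtain ⟨y, hy⟩ := (ShortComplex.moduleCat_exact_iff _).1 (hex (j - 1)).exact a ha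
    refine ⟨y, ?_⟩
    have hinj : Function.Injective (S.f.f j).hom :=
      (ModuleCat.mono_iff_injective _).1 (hex j).mono_f
    apply hinj
    refine (ConcreteCategory.congr_hom (S.f.comm (j - 1) j) y).symm.trans ?_
    exact (congrArg (B.d (j - 1) j).hom hy).trans hab
  refine (quasiIso_iff _).2 fun i => ?_
  rw [quasiIsoAt_iff_isIso_homologyMap]
  have : Mono (HomologicalComplex.homologyMap S.g i) := (hS.homology_exact₂ i).mono_g
    (((hacyc i).isZero_homology).eq_of_src _ _)
  have : Epi (HomologicalComplex.homologyMap S.g i) := (hS.homology_exact₃ i (i + 1) rfl).epi_f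
    (((hacyc (i + 1)).isZero_homology).eq_of_tgt _ _)
  exact isIso_of_mono_of_epi (HomologicalComplex.homologyMap S.g i)

/-! ### Simplicial homotopies and cocycles -/

section

variable {X Y : SSet.{0}} {f g : X ⟶ Y} {S : Type} [CommRing S]

/-- The additive functional on homomorphisms between free modules which evaluates a homomorphism
at a basis element and applies the linear extension of a function on the target basis. -/
def freeEval {T T' : Type} (φ : T' → S) (t : T) :
    ((ModuleCat.free ℤ).obj T ⟶ (ModuleCat.free ℤ).obj T') →+ S where
  toFun ψ := Finsupp.liftAddHom (fun y => (AddMonoidHom.smul (R := ℤ) (M := S)).flip (φ y))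
    (ψ.hom (ModuleCat.freeMk t))
  map_zero' := map_zero (Finsupp.liftAddHom _)
  map_add' ψ ψ' := map_add (Finsupp.liftAddHom _) (ψ.hom (ModuleCat.freeMk t))
    (ψ'.hom (ModuleCat.freeMk t))

@[simp]
lemma freeEval_map {T T' : Type} (φ : T' → S) (t : T) (a : T ⟶ T') :
    freeEval φ t ((ModuleCat.free ℤ).map a) = φ (a t) := by
  refine (congrArg (Finsupp.liftAddHom
    fun y => (AddMonoidHom.smul (R := ℤ) (M := S)).flip (φ y))
    (ModuleCat.free_map_apply (R := ℤ) a t)).trans ?_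
  refine (Finsupp.liftAddHom_apply_single _ _ _).trans ?_
  simp

@[simp]
lemma freeEval_map_comp_map {T T' T'' : Type} (φ : T'' → S) (t : T) (a : T ⟶ T') (b : T' ⟶ T'') :
    freeEval φ t ((ModuleCat.free ℤ).map a ≫ (ModuleCat.free ℤ).map b) = φ (b (a t)) := by
  rw [← Functor.map_comp, freeEval_map]
  rfl

/-- A cocycle of degree `0` takes the same values on homotopic simplices. -/
lemma cocycle_zero_homotopy (H : SimplicialObject.Homotopy f g) (φ : Y _⦋0⦌ → S)
    (hφ : ∀ z : Y _⦋1⦌, ∑ k : Fin 2, (-1 : ℤ) ^ (k : ℕ) • φ (Y.δ k z) = 0) (x : X _⦋0⦌) :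
    φ (f.app _ x) = φ (g.app _ x) := by
  have h₁ := congrArg φ (ConcreteCategory.congr_hom (H.h_zero_comp_δ_zero 0) x)
  have h₂ := congrArg φ (ConcreteCategory.congr_hom (H.h_last_comp_δ_last 0) x)
  rw [← h₁, ← h₂]
  have h₃ := hφ (H.h 0 x)
  rw [Fin.sum_univ_two] at h₃
  simp only [Fin.val_zero, Fin.val_one, pow_zero, pow_one, one_smul, neg_smul] at h₃
  exact (sub_eq_zero.1 (by rw [sub_eq_add_neg]; exact h₃)).symm

/-- The values of a cocycle on homotopic simplices differ by a coboundary. -/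
lemma cocycle_succ_homotopy (H : SimplicialObject.Homotopy f g) {n : ℕ} (φ : Y _⦋n + 1⦌ → S)
    (hφ : ∀ z : Y _⦋n + 2⦌, ∑ k : Fin (n + 3), (-1 : ℤ) ^ (k : ℕ) • φ (Y.δ k z) = 0)
    (x : X _⦋n + 1⦌) :
    φ (f.app _ x) = ∑ j : Fin (n + 2), (-1 : ℤ) ^ (j : ℕ) •
      (- ∑ k : Fin (n + 1), (-1 : ℤ) ^ (k : ℕ) • φ (H.h k (X.δ j x))) + φ (g.app _ x) := by
  -- The chain homotopy between the maps on free simplicial abelian groups. Extending `φ` linearly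
  -- and evaluating at `x` kills the middle term, because `φ` is a cocycle, and leaves the
  -- coboundary of `φ` composed with the homotopy.
  have key : (ModuleCat.free ℤ).map (f.app (op ⦋n + 1⦌)) =
      (∑ j : Fin (n + 2), (-1 : ℤ) ^ (j : ℕ) • (ModuleCat.free ℤ).map (X.δ j)) ≫
        (- ∑ k : Fin (n + 1), (-1 : ℤ) ^ (k : ℕ) • (ModuleCat.free ℤ).map (H.h k)) +
      (- ∑ k : Fin (n + 2), (-1 : ℤ) ^ (k : ℕ) • (ModuleCat.free ℤ).map (H.h k)) ≫
        (∑ j : Fin (n + 3), (-1 : ℤ) ^ (j : ℕ) • (ModuleCat.free ℤ).map (Y.δ j)) +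
      (ModuleCat.free ℤ).map (g.app (op ⦋n + 1⦌)) := by
    have := (H.whiskerRight (ModuleCat.free ℤ)).toChainHomotopy.comm (n + 1)
    rw [dNext_eq (i' := n) (w := by simp), prevD_eq (j' := n + 2) (w := by simp)] at this
    refine this.trans (congrArg₂ (· + ·) (congrArg₂ (· + ·) (congrArg₂ (· ≫ ·) ?_ ?_)
      (congrArg₂ (· ≫ ·) ?_ ?_)) rfl)
    · exact AlgebraicTopology.alternatingFaceMapComplex_obj_d _ _
    · exact SimplicialObject.Homotopy.ToChainHomotopy.hom_eq _ n
    · exact SimplicialObject.Homotopy.ToChainHomotopy.hom_eq _ (n + 1)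
    · exact AlgebraicTopology.alternatingFaceMapComplex_obj_d _ _
  have h := congrArg (freeEval φ x) key
  simp only [Preadditive.sum_comp, Preadditive.comp_sum, Preadditive.zsmul_comp,
    Preadditive.comp_zsmul, Preadditive.comp_neg, Preadditive.neg_comp, map_add, map_neg, map_sum,
    map_zsmul, freeEval_map, freeEval_map_comp_map] at h
  rw [h]
  congr 1
  simp only [smul_neg, Finset.smul_sum, Finset.sum_neg_distrib]
  refine (congrArg₂ (· + ·) (congrArg Neg.neg ?_) (neg_eq_zero.2 ?_)).trans (add_zero _)
  · rw [Finset.sum_comm]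
    exact Finset.sum_congr rfl fun j _ => Finset.sum_congr rfl fun k _ => smul_comm _ _ _
  · rw [Finset.sum_comm]
    refine Finset.sum_eq_zero fun k _ => ?_
    refine (Finset.sum_congr rfl fun j _ => smul_comm _ _ _).trans ?_
    rw [← Finset.smul_sum, hφ, smul_zero]

end

/-! ### Coefficient systems -/

/-- A system of coefficients on a simplicial set `Y`: a subgroup of `S` for each simplex of `Y`,
such that the subgroup of a face is contained in that of the simplex. -/
@[ext]
structure Coeff (Y : SSet.{0}) (S : Type) [CommRing S] where
  val {n : SimplexCategoryᵒᵖ} : Y.obj n → AddSubgroup S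
  val_map_le {n m : SimplexCategoryᵒᵖ} (f : n ⟶ m) (y : Y.obj n) : val (Y.map f y) ≤ val y

namespace normCochains

variable {X Y : SSet.{0}} {S : Type} [CommRing S]

lemma ext_apply {q : ℤ} {f g : normCochains Y S q} (h : ∀ n y, f.1 n y = g.1 n y) : f = g :=
  Subtype.ext (funext fun n => funext fun y => h n y)

lemma map_d {R : Type} [CommRing R] (g : X ⟶ Y) (φ : S →+* R) {i j : ℤ} (hij : i + 1 = j)
    (f : normCochains Y S i) : map g φ j (d Y S hij f) = d X R hij (map g φ i f) := by
  have := ConcreteCategory.congr_hom ((cochainMap g φ).comm i j) f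
  subst hij
  simp only [cochainCplx, dif_pos] at this
  exact this.symm

lemma d_d {i j k : ℤ} (hij : i + 1 = j) (hjk : j + 1 = k) (f : normCochains Y S i) :
    d Y S hjk (d Y S hij f) = 0 :=
  Subtype.ext (dFun_dFun hij hjk f.1)

end normCochains

namespace Coeff

open normCochains

variable {X Y : SSet.{0}} {S : Type} [CommRing S]

instance : LE (Coeff Y S) where
  le τ τ' := ∀ {n : SimplexCategoryᵒᵖ} (y : Y.obj n), τ.val y ≤ τ'.val y

instance : Bot (Coeff Y S) where
  bot := { val := fun _ => ⊥, val_map_le := fun _ _ => le_rfl }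

/-- The pullback of a system of coefficients. -/
def comap (g : X ⟶ Y) (τ : Coeff Y S) : Coeff X S where
  val x := τ.val (g.app _ x)
  val_map_le f x := by
    rw [NatTrans.naturality_apply]
    exact τ.val_map_le f _

open Classical in
/-- The system of coefficients which is `τ₀` on a subcomplex and `τ₁` outside. -/
def ite (B : Y.Subcomplex) (τ₀ τ₁ : Coeff Y S) (h : τ₀ ≤ τ₁) : Coeff Y S where
  val {n} y := if y ∈ B.obj n then τ₀.val y else τ₁.val y
  val_map_le {n m} f y := by
    by_cases hy : y ∈ B.obj n
    · rw [if_pos hy, if_pos (show Y.map f y ∈ B.obj m from B.map f hy)]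
      exact τ₀.val_map_le f y
    · rw [if_neg hy]
      split_ifs
      · exact (h _).trans (τ₁.val_map_le f y)
      · exact τ₁.val_map_le f y

lemma ite_of_mem {B : Y.Subcomplex} {τ₀ τ₁ : Coeff Y S} (h : τ₀ ≤ τ₁) {n : SimplexCategoryᵒᵖ}
    {y : Y.obj n} (hy : y ∈ B.obj n) : (ite B τ₀ τ₁ h).val y = τ₀.val y := if_pos hy

lemma ite_of_notMem {B : Y.Subcomplex} {τ₀ τ₁ : Coeff Y S} (h : τ₀ ≤ τ₁) {n : SimplexCategoryᵒᵖ}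
    {y : Y.obj n} (hy : y ∉ B.obj n) : (ite B τ₀ τ₁ h).val y = τ₁.val y := if_neg hy

lemma bot_le (τ : Coeff Y S) : (⊥ : Coeff Y S) ≤ τ := fun _ => _root_.bot_le

lemma ite_le {B : Y.Subcomplex} {τ₀ τ₁ : Coeff Y S} (h : τ₀ ≤ τ₁) : ite B τ₀ τ₁ h ≤ τ₁ := by
  intro n y
  by_cases hy : y ∈ B.obj n
  · rw [ite_of_mem h hy]
    exact h y
  · rw [ite_of_notMem h hy]

/-- The system of coefficients `τ` relative to a subcomplex. -/
abbrev rel (B : Y.Subcomplex) (τ : Coeff Y S) : Coeff Y S := ite B ⊥ τ τ.bot_le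

/-- A normalized cochain has coefficients in `τ`. -/
def Mem (τ : Coeff Y S) {q : ℤ} (f : normCochains Y S q) : Prop := ∀ n y, f.1 n y ∈ τ.val y

variable {τ τ₀ τ₁ : Coeff Y S}

lemma Mem.zero {q : ℤ} : τ.Mem (0 : normCochains Y S q) := fun _ _ => zero_mem _

lemma Mem.add {q : ℤ} {f g : normCochains Y S q} (hf : τ.Mem f) (hg : τ.Mem g) : τ.Mem (f + g) :=
  fun n y => add_mem (hf n y) (hg n y)

lemma Mem.sub {q : ℤ} {f g : normCochains Y S q} (hf : τ.Mem f) (hg : τ.Mem g) : τ.Mem (f - g) :=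
  fun n y => sub_mem (hf n y) (hg n y)

lemma Mem.d {i j : ℤ} {f : normCochains Y S i} (hf : τ.Mem f) (hij : i + 1 = j) :
    τ.Mem (d Y S hij f) := by
  rintro ⟨_ | n, h⟩ y
  · exact zero_mem _
  · change ∑ k : Fin (n + 2), (-1 : ℤ) ^ (k : ℕ) • f.1 ⟨n, by omega⟩ (Y.δ k y) ∈ τ.val y
    refine sum_mem fun k _ => zsmul_mem ?_ _
    exact (show τ.val (Y.δ k y) ≤ τ.val y from τ.val_map_le _ y)
      (hf ⟨n, by omega⟩ (Y.δ k y))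

lemma Mem.mono {q : ℤ} {f : normCochains Y S q} (hf : τ₀.Mem f) (h : τ₀ ≤ τ₁) : τ₁.Mem f :=
  fun n y => h y (hf n y)

lemma Mem.comap {q : ℤ} {f : normCochains Y S q} (hf : τ.Mem f) (g : X ⟶ Y) :
    (τ.comap g).Mem (normCochains.map g (RingHom.id S) q f) :=
  fun n x => hf n (g.app _ x)

/-- The complex of normalized cochains with coefficients in `τ` is acyclic. -/
def Acyclic (τ : Coeff Y S) : Prop :=
  ∀ (i j k : ℤ) (hij : i + 1 = j) (hjk : j + 1 = k) (f : normCochains Y S j), τ.Mem f →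
    normCochains.d Y S hjk f = 0 → ∃ g : normCochains Y S i, τ.Mem g ∧ normCochains.d Y S hij g = f

/-- The quotient of the complex of cochains with coefficients in `τ₁` by the subcomplex of those
with coefficients in `τ₀` is acyclic. -/
def AcyclicQuotient (τ₀ τ₁ : Coeff Y S) : Prop :=
  ∀ (i j k : ℤ) (hij : i + 1 = j) (hjk : j + 1 = k) (u : normCochains Y S j), τ₁.Mem u →
    τ₀.Mem (normCochains.d Y S hjk u) →
    ∃ v : normCochains Y S i, τ₁.Mem v ∧ τ₀.Mem (u - normCochains.d Y S hij v)

/-- Two thirds of a short exact sequence of complexes being acyclic, so is the last, here by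
chasing: `du` is a cocycle over `τ₀`, hence `du = dc` over `τ₀`, and the cocycle `u - c` is a
coboundary over `τ₁`. -/
lemma Acyclic.quotient (h₀ : τ₀.Acyclic) (h₁ : τ₁.Acyclic) (h : τ₀ ≤ τ₁) :
    AcyclicQuotient τ₀ τ₁ := by
  intro i j k hij hjk u hu hdu
  obtain ⟨c, hc, hcu⟩ := h₀ j k (k + 1) hjk rfl _ hdu (d_d _ _ _)
  obtain ⟨v, hv, hvu⟩ := h₁ i j k hij hjk (u - c) (hu.sub (hc.mono h)) (by
    rw [map_sub, hcu, sub_self])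
  exact ⟨v, hv, by rwa [hvu, sub_sub_cancel]⟩

lemma Acyclic.comap_iso (e : X ≅ Y) (h : (τ.comap e.hom).Acyclic) : τ.Acyclic := by
  intro i j k hij hjk f hf hdf
  obtain ⟨g, hg, hgf⟩ := h i j k hij hjk (normCochains.map e.hom (RingHom.id S) j f)
    (hf.comap _) (by rw [← map_d, hdf, map_zero])
  refine ⟨normCochains.map e.inv (RingHom.id S) i g, fun n y => ?_, ?_⟩
  · have := hg.comap e.inv n y
    have h' : e.hom.app _ (e.inv.app _ y) = y := by simp
    simpa [comap, h'] using! this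
  · rw [← map_d, hgf]
    refine ext_apply fun n y => ?_
    have h' : e.hom.app _ (e.inv.app _ y) = y := by simp
    exact congrArg (f.1 n) h'

end Coeff

/-! ### Acyclicity for cylinders and horns -/

section

open MonoidalCategory CartesianMonoidalCategory

/-- The morphism `Δ[1] ⊗ Δ[1] ⟶ Δ[1]` given by a monotone map on the vertices. -/
def squareMap (φ : Fin 2 × Fin 2 →o Fin 2) : (Δ[1] ⊗ Δ[1] : SSet.{0}) ⟶ Δ[1] where
  app _ := ↾fun s => SSet.stdSimplex.objMk
    (φ.comp ((SSet.stdSimplex.asOrderHom s.1).prod (SSet.stdSimplex.asOrderHom s.2)))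
  naturality _ _ _ := rfl

/-- The vertices of `Δ[1]`, as subcomplexes. -/
abbrev endpoint (k : Fin 2) : (Δ[1] : SSet.{0}).Subcomplex := SSet.stdSimplex.face {k}

/-- The ends of a cylinder. -/
abbrev cylinderEnd (X : SSet.{0}) (k : Fin 2) : (X ⊗ Δ[1] : SSet.{0}).Subcomplex :=
  (endpoint k).preimage (snd X Δ[1])

lemma eq_of_mem_endpoint {k : Fin 2} {n : SimplexCategoryᵒᵖ} {s t : (Δ[1] : SSet.{0}).obj n}
    (hs : s ∈ (endpoint k).obj n) (ht : t ∈ (endpoint k).obj n) : s = t := by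
  induction n using Opposite.rec with | _ n
  induction n using SimplexCategory.rec with | _ n
  ext i
  have h₁ := (SSet.stdSimplex.mem_face_iff _ _).1 hs i
  have h₂ := (SSet.stdSimplex.mem_face_iff _ _).1 ht i
  rw [Finset.mem_singleton.1 h₁, Finset.mem_singleton.1 h₂]

lemma ι₀_mem_cylinderEnd {X : SSet.{0}} {n : SimplexCategoryᵒᵖ} (x : X.obj n) :
    (SSet.ι₀ (X := X)).app n x ∈ (cylinderEnd X 0).obj n := by
  induction n using Opposite.rec with | _ n
  induction n using SimplexCategory.rec with | _ n
  exact (SSet.stdSimplex.mem_face_iff _ _).2 fun i => Finset.mem_singleton.2 rfl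

lemma ι₁_mem_cylinderEnd {X : SSet.{0}} {n : SimplexCategoryᵒᵖ} (x : X.obj n) :
    (SSet.ι₁ (X := X)).app n x ∈ (cylinderEnd X 1).obj n := by
  induction n using Opposite.rec with | _ n
  induction n using SimplexCategory.rec with | _ n
  exact (SSet.stdSimplex.mem_face_iff _ _).2 fun i => Finset.mem_singleton.2 rfl

lemma ι₀_app_fst_of_mem {X : SSet.{0}} {n : SimplexCategoryᵒᵖ} {y : (X ⊗ Δ[1] : SSet.{0}).obj n}
    (hy : y ∈ (cylinderEnd X 0).obj n) : (SSet.ι₀ (X := X)).app n y.1 = y :=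
  Prod.ext rfl (eq_of_mem_endpoint (ι₀_mem_cylinderEnd y.1) hy)

lemma cylinderEnd_disjoint {X : SSet.{0}} {n : SimplexCategoryᵒᵖ} {y : (X ⊗ Δ[1] : SSet.{0}).obj n}
    (h₀ : y ∈ (cylinderEnd X 0).obj n) : y ∉ (cylinderEnd X 1).obj n := by
  intro h₁
  induction n using Opposite.rec with | _ n
  induction n using SimplexCategory.rec with | _ n
  have h₀' := (SSet.stdSimplex.mem_face_iff _ _).1 h₀ 0
  have h₁' := (SSet.stdSimplex.mem_face_iff _ _).1 h₁ 0
  rw [Finset.mem_singleton] at h₀' h₁'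
  exact zero_ne_one (h₀'.symm.trans h₁')

/-- Constructor for homotopies. -/
def SSet.Homotopy.mk' {X Y : SSet.{0}} {f g : X ⟶ Y} (h : X ⊗ Δ[1] ⟶ Y) (h₀ : SSet.ι₀ ≫ h = f)
    (h₁ : SSet.ι₁ ≫ h = g) : SSet.Homotopy f g where
  h := h
  h₀ := h₀
  h₁ := h₁
  rel := by
    ext n y
    exact (y.1.2 : False).elim

/-- The contraction of a cylinder onto its end. -/
def cylinderContraction (X : SSet.{0}) :
    SSet.Homotopy (𝟙 (X ⊗ Δ[1])) (fst X Δ[1] ≫ SSet.ι₁) :=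
  .mk' ((α_ X Δ[1] Δ[1]).hom ≫
      X ◁ squareMap ⟨fun a => a.1 ⊔ a.2, fun _ _ h => sup_le_sup h.1 h.2⟩)
    (CartesianMonoidalCategory.hom_ext _ _ rfl (by
      ext n y
      induction n using Opposite.rec with | _ n
      induction n using SimplexCategory.rec with | _ n
      exact SSet.stdSimplex.ext _ _ fun i => max_eq_left (Fin.zero_le _)))
    (CartesianMonoidalCategory.hom_ext _ _ rfl (by
      ext n y
      induction n using Opposite.rec with | _ n
      induction n using SimplexCategory.rec with | _ n
      exact SSet.stdSimplex.ext _ _ fun i => max_eq_right (Fin.le_last _)))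

/-- The simplices of the prism decomposition of the contraction of a cylinder. -/
abbrev prism (X : SSet.{0}) {n : ℕ} (k : Fin (n + 1)) (y : (X ⊗ Δ[1] : SSet.{0}) _⦋n⦌) :
    (X ⊗ Δ[1] : SSet.{0}) _⦋n + 1⦌ :=
  (cylinderContraction X).toSimplicialObjectHomotopy.h k y

lemma prism_eq (X : SSet.{0}) {n : ℕ} (k : Fin (n + 1)) (y : (X ⊗ Δ[1] : SSet.{0}) _⦋n⦌) :
    prism X k y = (X.σ k y.1, (squareMap ⟨fun a => a.1 ⊔ a.2, fun _ _ h => sup_le_sup h.1 h.2⟩).app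
      (op ⦋n + 1⦌) ((Δ[1] : SSet.{0}).σ k y.2, SSet.stdSimplex.objMk₁ k.succ.castSucc)) :=
  rfl

/-- The contraction is a maximum, so it fixes the end `1`. Hence the prism operator preserves
vanishing there. -/
lemma prism_mem (X : SSet.{0}) {n : ℕ} (k : Fin (n + 1)) (y : (X ⊗ Δ[1] : SSet.{0}) _⦋n⦌)
    (hy : y ∈ (cylinderEnd X 1).obj _) : prism X k y ∈ (cylinderEnd X 1).obj _ := by
  rw [prism_eq]
  refine (SSet.stdSimplex.mem_face_iff _ _).2 fun i => Finset.mem_singleton.2 ?_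
  refine Eq.trans ?_ (max_eq_left (Fin.le_last
    ((SSet.stdSimplex.objMk₁ k.succ.castSucc : (Δ[1] : SSet.{0}) _⦋n + 1⦌) i)))
  refine congrArg₂ max ?_ rfl
  exact Finset.mem_singleton.1 ((SSet.stdSimplex.mem_face_iff _ _).1
    ((cylinderEnd X 1).map (SimplexCategory.σ k).op hy) i)

/-- Needed so that the prism operator takes normalized cochains to normalized cochains. -/
lemma SSet.Homotopy.degenerate {X Y : SSet.{0}} {f g : X ⟶ Y} (H : SimplicialObject.Homotopy f g)
    {n : ℕ} (k : Fin (n + 1)) {x : X _⦋n⦌} (hx : x ∈ X.degenerate n) :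
    H.h k x ∈ Y.degenerate (n + 1) := by
  obtain _ | n := n
  · simp at hx
  rw [SSet.degenerate_eq_iUnion_range_σ, Set.mem_iUnion] at hx
  obtain ⟨i, z, rfl⟩ := hx
  by_cases h : k ≤ i.castSucc
  · obtain ⟨j, rfl⟩ := Fin.exists_castSucc_eq.2
      (show k ≠ Fin.last _ from (h.trans_lt (Fin.castSucc_lt_last i)).ne)
    have : Y.σ i.succ (H.h j z) = H.h j.castSucc (X.σ i z) :=
      ConcreteCategory.congr_hom (H.h_comp_σ_succ_of_lt i j (by simpa using h)) z
    rw [← this]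
    exact Y.σ_mem_degenerate _ _
  · obtain ⟨j, rfl⟩ := Fin.exists_succ_eq.2 (show k ≠ 0 by rintro rfl; simp at h)
    have : Y.σ i.castSucc (H.h j z) = H.h j.succ (X.σ i z) :=
      ConcreteCategory.congr_hom (H.h_comp_σ_castSucc_of_le i j (by
        simp only [Fin.le_def, Fin.val_succ, Fin.val_castSucc] at h ⊢
        omega)) z
    rw [← this]
    exact Y.σ_mem_degenerate _ _

end

/-! ### Acyclic complexes of relative cochains with variable coefficients -/

namespace Coeff

open normCochains MonoidalCategory CartesianMonoidalCategory

variable {X : SSet.{0}} {S : Type} [CommRing S]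

/-- Coefficients on a cylinder relative to its end `1` form an acyclic complex. -/
lemma acyclic_cylinder (τ : Coeff X S) :
    (rel (cylinderEnd X 1) (τ.comap (fst X Δ[1]))).Acyclic := by
  intro i j k hij hjk f hf hdf
  have hf₁ (n) (y : (X ⊗ Δ[1] : SSet.{0}) _⦋n.1⦌) (hy : y ∈ (cylinderEnd X 1).obj _) :
      f.1 n y = 0 := by
    have := hf n y
    rwa [ite_of_mem _ hy] at this
  have hf₂ (n : ℕ) (hn : (n : ℤ) = j) (z : (X ⊗ Δ[1] : SSet.{0}) _⦋n + 1⦌) :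
      ∑ l : Fin (n + 2), (-1 : ℤ) ^ (l : ℕ) • f.1 ⟨n, hn⟩ ((X ⊗ Δ[1] : SSet.{0}).δ l z) = 0 :=
    congrFun (congrFun (congrArg Subtype.val hdf) ⟨n + 1, by push_cast; omega⟩) z
  let H := (cylinderContraction X).toSimplicialObjectHomotopy
  -- The prism operator applied to `f`, with the sign of `cocycle_succ_homotopy`. The contraction
  -- deforms the identity to the projection to the end `1`, where `f` vanishes, so `f` is the
  -- coboundary of this cochain.
  refine ⟨⟨fun n y => - ∑ l : Fin (n.1 + 1), (-1 : ℤ) ^ (l : ℕ) •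
    f.1 ⟨n.1 + 1, by push_cast; have := n.2; omega⟩ (prism X l y), fun n y hy => ?_⟩, ?_, ?_⟩
  · refine neg_eq_zero.2 (Finset.sum_eq_zero fun l _ => ?_)
    rw [f.2 _ _ (SSet.Homotopy.degenerate H l hy), smul_zero]
  · intro n y
    refine neg_mem (sum_mem fun l _ => zsmul_mem ?_ _)
    have := hf ⟨n.1 + 1, by push_cast; have := n.2; omega⟩ (prism X l y)
    by_cases hy : y ∈ (cylinderEnd X 1).obj _
    · rw [ite_of_mem _ (prism_mem X l y hy)] at this
      rwa [ite_of_mem _ hy]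
    · rw [ite_of_notMem _ hy]
      -- A prism only degenerates the coordinate in `X`, so its coefficients are no larger than
      -- those of `y`.
      have hle : τ.val (prism X l y).1 ≤ τ.val y.1 := by
        rw [prism_eq]
        exact τ.val_map_le _ _
      exact hle (ite_le (bot_le (τ.comap (fst X Δ[1]))) (prism X l y) this)
  · refine ext_apply fun ⟨n, hn⟩ y => ?_
    obtain _ | n := n
    · refine Eq.trans ?_ (cocycle_zero_homotopy H (f.1 ⟨0, hn⟩) (hf₂ 0 hn) y).symm
      exact (hf₁ _ _ (ι₁_mem_cylinderEnd _)).symm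
    · refine Eq.trans ?_ (cocycle_succ_homotopy H (f.1 ⟨n + 1, hn⟩) (hf₂ (n + 1) hn) y).symm
      refine (add_zero _).symm.trans (congrArg₂ (· + ·) rfl ?_)
      exact (hf₁ _ _ (ι₁_mem_cylinderEnd _)).symm

open Classical in
/-- The cochain which agrees with `f` on a subcomplex and is zero on the other simplices. -/
def cutoff {Y : SSet.{0}} (B : Y.Subcomplex) {q : ℤ} (f : normCochains Y S q) :
    normCochains Y S q :=
  ⟨fun n y => if y ∈ B.obj _ then f.1 n y else 0, fun n y hy => by
    change (if y ∈ B.obj _ then f.1 n y else 0) = 0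
    rw [f.2 n y hy, ite_self]⟩

lemma cutoff_of_mem {Y : SSet.{0}} {B : Y.Subcomplex} {q : ℤ} (f : normCochains Y S q) (n)
    {y : Y _⦋n.1⦌} (hy : y ∈ B.obj _) : (cutoff B f).1 n y = f.1 n y := if_pos hy

lemma cutoff_of_notMem {Y : SSet.{0}} {B : Y.Subcomplex} {q : ℤ} (f : normCochains Y S q) (n)
    {y : Y _⦋n.1⦌} (hy : y ∉ B.obj _) : (cutoff B f).1 n y = 0 := if_neg hy

lemma comap_mono {Y : SSet.{0}} (g : X ⟶ Y) {τ₀ τ₁ : Coeff Y S} (h : τ₀ ≤ τ₁) :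
    τ₀.comap g ≤ τ₁.comap g :=
  fun x => h (g.app _ x)

/-- The coefficients on a cylinder which are `σ₀` at the end `0` and `σ₁` elsewhere. -/
abbrev path (σ₀ σ₁ : Coeff X S) (h : σ₀ ≤ σ₁) : Coeff (X ⊗ Δ[1]) S :=
  ite (cylinderEnd X 0) (σ₀.comap (fst X Δ[1])) (σ₁.comap (fst X Δ[1])) (comap_mono _ h)

lemma rel_mono {Y : SSet.{0}} (B : Y.Subcomplex) {τ₀ τ₁ : Coeff Y S} (h : τ₀ ≤ τ₁) :
    rel B τ₀ ≤ rel B τ₁ := by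
  intro n y
  by_cases hy : y ∈ B.obj n
  · rw [ite_of_mem _ hy]
    exact _root_.bot_le
  · rw [ite_of_notMem _ hy, ite_of_notMem _ hy]
    exact h y

lemma mem_rel_iff {Y : SSet.{0}} {B : Y.Subcomplex} {τ : Coeff Y S} {q : ℤ}
    {f : normCochains Y S q} :
    (rel B τ).Mem f ↔ (∀ n y, y ∈ B.obj _ → f.1 n y = 0) ∧ τ.Mem f := by
  refine ⟨fun hf => ⟨fun n y hy => ?_, hf.mono (ite_le _)⟩, fun ⟨h₁, h₂⟩ n y => ?_⟩
  · have := hf n y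
    rwa [ite_of_mem _ hy] at this
  · by_cases hy : y ∈ B.obj _
    · rw [ite_of_mem _ hy, h₁ n y hy]
      exact zero_mem _
    · rw [ite_of_notMem _ hy]
      exact h₂ n y

lemma mem_ite_iff {Y : SSet.{0}} {B : Y.Subcomplex} {τ₀ τ₁ : Coeff Y S} (h : τ₀ ≤ τ₁) {q : ℤ}
    {f : normCochains Y S q} :
    (ite B τ₀ τ₁ h).Mem f ↔ (∀ n y, y ∈ B.obj _ → f.1 n y ∈ τ₀.val y) ∧ τ₁.Mem f := by
  refine ⟨fun hf => ⟨fun n y hy => ?_, hf.mono (ite_le _)⟩, fun ⟨h₁, h₂⟩ n y => ?_⟩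
  · have := hf n y
    rwa [ite_of_mem _ hy] at this
  · by_cases hy : y ∈ B.obj _
    · rw [ite_of_mem _ hy]
      exact h₁ n y hy
    · rw [ite_of_notMem _ hy]
      exact h₂ n y

lemma mem_path_iff {σ₀ σ₁ : Coeff X S} (h : σ₀ ≤ σ₁) {q : ℤ} {f : normCochains (X ⊗ Δ[1]) S q} :
    (path σ₀ σ₁ h).Mem f ↔ (∀ n y, y ∈ (cylinderEnd X 0).obj _ → f.1 n y ∈ σ₀.val y.1) ∧
      (σ₁.comap (fst X Δ[1])).Mem f :=
  mem_ite_iff (comap_mono _ h)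

/-- Any cochain on the end `0` extends to the cylinder by zero, keeping its coefficients and
vanishing at the end `1`. This allows corrections to be made at the end `0` alone. -/
lemma mem_rel_cutoff {q : ℤ} {v : normCochains X S q} {σ : Coeff X S} (hv : σ.Mem v) :
    (rel (cylinderEnd X 1) (σ.comap (fst X Δ[1]))).Mem
      (cutoff (cylinderEnd X 0) (normCochains.map (fst X Δ[1]) (RingHom.id S) q v)) := by
  refine mem_rel_iff.2 ⟨fun n y hy => cutoff_of_notMem _ _ fun h => cylinderEnd_disjoint h hy,
    fun n y => ?_⟩
  by_cases hy : y ∈ (cylinderEnd X 0).obj _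
  · rw [cutoff_of_mem _ _ hy]
    exact hv n y.1
  · rw [cutoff_of_notMem _ _ hy]
    exact zero_mem _

lemma map_ι₀_cutoff {q : ℤ} (v : normCochains X S q) :
    normCochains.map SSet.ι₀ (RingHom.id S) q
      (cutoff (cylinderEnd X 0) (normCochains.map (fst X Δ[1]) (RingHom.id S) q v)) = v :=
  ext_apply fun _ x => cutoff_of_mem _ _ (ι₀_mem_cylinderEnd x)

lemma apply_eq_map_ι₀ {q : ℤ} (f : normCochains (X ⊗ Δ[1]) S q) (n)
    {y : (X ⊗ Δ[1] : SSet.{0}) _⦋n.1⦌} (hy : y ∈ (cylinderEnd X 0).obj _) :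
    f.1 n y = (normCochains.map SSet.ι₀ (RingHom.id S) q f).1 n y.1 :=
  congrArg (f.1 n) (ι₀_app_fst_of_mem hy).symm

/-- Up to homotopy this complex is the mapping cone of the inclusion of `σ₀`-cochains in
`σ₁`-cochains, shifted, so it is acyclic when the quotient is. Concretely, a cocycle has a primitive
`g` over `σ₁`. At the end `0`, `g` is a cocycle modulo `σ₀`, hence equal to some `dv` modulo `σ₀`;
subtracting `dV`, where `V` extends `v` by zero, repairs the coefficients without changing `dg`. -/
lemma acyclic_path {σ₀ σ₁ : Coeff X S} (h : σ₀ ≤ σ₁) (hq : AcyclicQuotient σ₀ σ₁) :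
    (rel (cylinderEnd X 1) (path σ₀ σ₁ h)).Acyclic := by
  intro i j k hij hjk f hf hdf
  obtain ⟨hf₁, hf₂⟩ := mem_rel_iff.1 hf
  obtain ⟨hf₃, hf₄⟩ := (mem_path_iff h).1 hf₂
  obtain ⟨g, hg, rfl⟩ := acyclic_cylinder σ₁ i j k hij hjk f (mem_rel_iff.2 ⟨hf₁, hf₄⟩) hdf
  obtain ⟨v, hv, hv'⟩ := hq (i - 1) i j (by omega) hij
    (normCochains.map SSet.ι₀ (RingHom.id S) i g) (fun n x => (mem_rel_iff.1 hg).2 n (SSet.ι₀.app _ x)) (by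
      rw [← map_d]
      exact fun n x => hf₃ n _ (ι₀_mem_cylinderEnd x))
  let V := cutoff (cylinderEnd X 0) (normCochains.map (fst X Δ[1]) (RingHom.id S) (i - 1) v)
  have hV := hg.sub ((mem_rel_cutoff hv).d (show i - 1 + 1 = i by omega))
  refine ⟨g - d _ S (by omega) V, mem_rel_iff.2 ⟨(mem_rel_iff.1 hV).1, (mem_path_iff h).2
    ⟨fun n y hy => ?_, (mem_rel_iff.1 hV).2⟩⟩, by rw [map_sub, d_d, sub_zero]⟩
  rw [apply_eq_map_ι₀ _ n hy, map_sub, map_d, map_ι₀_cutoff]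
  exact hv' n y.1

instance {Y : SSet.{0}} : Min (Coeff Y S) where
  min a b :=
    { val := fun y => a.val y ⊓ b.val y
      val_map_le := fun f y => inf_le_inf (a.val_map_le f y) (b.val_map_le f y) }

lemma inf_le_right {Y : SSet.{0}} (a b : Coeff Y S) : a ⊓ b ≤ b := fun _ => _root_.inf_le_right

/-- The Mayer–Vietoris step. The two relative path complexes are, up to the same shift, models of
b/(a ∩ b) and c/a, and these quotients agree because `c` is contained in a + b (`hc`). -/
lemma acyclicQuotient_path {a b c : Coeff X S} (hac : a ≤ c) (hbc : b ≤ c)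
    (hc : ∀ {n : SimplexCategoryᵒᵖ} (x : X.obj n), c.val x ≤ a.val x ⊔ b.val x) :
    AcyclicQuotient (rel (cylinderEnd X 1) (path (a ⊓ b) b (a.inf_le_right b)))
      (rel (cylinderEnd X 1) (path a c hac)) := by
  intro i j k hij hjk u hu hdu
  obtain ⟨hu₁, hu₂⟩ := mem_rel_iff.1 hu
  obtain ⟨hu₃, hu₄⟩ := (mem_path_iff hac).1 hu₂
  -- `du` has coefficients in `b`, so `du = dw` with `w` over `b`. Then `u - w` is a cocycle over
  -- `c`, hence equal to some `dg`.
  obtain ⟨w, hw, hwu⟩ := acyclic_cylinder b j k (k + 1) hjk rfl (d _ S hjk u)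
    (mem_rel_iff.2 ⟨(mem_rel_iff.1 hdu).1, ((mem_path_iff (a.inf_le_right b)).1 (mem_rel_iff.1 hdu).2).2⟩) (d_d _ _ _)
  have hbc' : (b.comap (fst X Δ[1])) ≤ (c.comap (fst X Δ[1])) := fun y => hbc y.1
  obtain ⟨g, hg, hgu⟩ := acyclic_cylinder c i j k hij hjk (u - w)
    ((mem_rel_iff.2 ⟨hu₁, hu₄⟩).sub (hw.mono (rel_mono _ hbc'))) (by rw [map_sub, hwu, sub_self])
  -- At the end `0` the values of `g` are split as a sum from `a` and `b`, simplex by simplex. The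
  -- last clause makes the `b`-part a normalized cochain. Removing this part from `g` gives an
  -- admissible primitive, and the error `w + dV` has coefficients in `b`.
  have hg₂ (n) (x : X _⦋n.1⦌) : ∃ s : S, s ∈ b.val x ∧
      g.1 n (SSet.ι₀.app _ x) - s ∈ a.val x ∧ (x ∈ X.degenerate n.1 → s = 0) := by
    by_cases hx : x ∈ X.degenerate n.1
    · refine ⟨0, zero_mem _, ?_, fun _ => rfl⟩
      rw [g.2 n _ (SSet.degenerate_app_apply hx _), sub_zero]
      exact zero_mem _
    · obtain ⟨r, hr, s, hs, hrs⟩ := AddSubgroup.mem_sup.1 (hc x ((mem_rel_iff.1 hg).2 n (SSet.ι₀.app _ x)))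
      exact ⟨s, hs, by rwa [← hrs, add_sub_cancel_right], fun h => (hx h).elim⟩
  choose s hsb hsa hs₀ using hg₂
  let v₀ : normCochains X S i := ⟨s, hs₀⟩
  let V := cutoff (cylinderEnd X 0) (normCochains.map (fst X Δ[1]) (RingHom.id S) i v₀)
  have hV : (rel (cylinderEnd X 1) (b.comap (fst X Δ[1]))).Mem V := mem_rel_cutoff hsb
  have hgV := hg.sub (hV.mono (rel_mono _ hbc'))
  have hmem : (rel (cylinderEnd X 1) (path a c hac)).Mem (g - V) := by
    refine mem_rel_iff.2 ⟨(mem_rel_iff.1 hgV).1, (mem_path_iff hac).2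
      ⟨fun n y hy => ?_, (mem_rel_iff.1 hgV).2⟩⟩
    rw [apply_eq_map_ι₀ _ n hy, map_sub, map_ι₀_cutoff]
    exact hsa n y.1
  refine ⟨g - V, hmem, ?_⟩
  have hu' := hu.sub (hmem.d hij)
  have heq : u - d _ S hij (g - V) = w + d _ S hij V := by
    rw [map_sub, hgu]
    abel
  have hb := hw.add (hV.d hij)
  refine mem_rel_iff.2 ⟨(mem_rel_iff.1 hu').1,
    (mem_path_iff (a.inf_le_right b)).2 ⟨fun n y hy => ⟨?_, ?_⟩, ?_⟩⟩
  -- At the end `0` the error also lies in `a`, as a difference of two cochains that do; together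
  -- with the next case this gives a ∩ b.
  · exact ((mem_path_iff hac).1 (mem_rel_iff.1 hu').2).1 n y hy
  · rw [heq]
    exact (mem_rel_iff.1 hb).2 n y
  · rw [heq]
    exact (mem_rel_iff.1 hb).2

/-- The constant system of coefficients. -/
def const (Y : SSet.{0}) (R : AddSubgroup S) : Coeff Y S where
  val _ := R
  val_map_le _ _ := le_rfl

/-- A cochain on a simplex which vanishes on a horn and at the remaining face vanishes
in all degrees other than the top one. -/
lemma eq_zero_of_horn {n : ℕ} {i : Fin (n + 2)} {q : ℤ} (hq : q ≠ n + 1)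
    {f : normCochains Δ[n + 1] S q} (hf : ∀ m s, s ∈ (Λ[n + 1, i]).obj _ → f.1 m s = 0)
    (hf' : ∀ h : (n : ℤ) = q,
      f.1 ⟨n, h⟩ (SSet.stdSimplex.objEquiv.symm (SimplexCategory.δ i)) = 0) : f = 0 := by
  refine ext_apply fun ⟨m, hm⟩ s => ?_
  by_cases hs : s ∈ (Δ[n + 1] : SSet.{0}).degenerate m
  · exact f.2 _ s hs
  rw [← SSet.mem_nonDegenerate_iff_notMem_degenerate, SSet.stdSimplex.mem_nonDegenerate_iff_mono] at hs
  have hle := SimplexCategory.len_le_of_mono (SSet.stdSimplex.objEquiv s)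
  change m ≤ n + 1 at hle
  obtain h | h : m < n ∨ m = n := by omega
  · refine hf _ s ?_
    rw [SSet.horn_obj_eq_univ i m]
    exact Set.mem_univ _
  · subst h
    obtain ⟨j, hj⟩ := SimplexCategory.eq_δ_of_mono (SSet.stdSimplex.objEquiv s)
    obtain rfl := (SSet.stdSimplex.objEquiv.eq_symm_apply.2 hj)
    by_cases hij : j = i
    · subst hij
      exact hf' hm
    · exact hf _ _ ((SSet.objEquiv_symm_δ_mem_horn_iff j i).2 hij)

lemma δ_id_eq {n : ℕ} (k : Fin (n + 2)) :
    (Δ[n + 1] : SSet.{0}).δ k (SSet.stdSimplex.objEquiv.symm (𝟙 ⦋n + 1⦌)) =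
      SSet.stdSimplex.objEquiv.symm (SimplexCategory.δ k) := by
  apply SSet.stdSimplex.objEquiv.injective
  exact Category.comp_id (SimplexCategory.δ k)

open Classical in
/-- The cochains on a simplex relative to a horn form an acyclic complex. -/
lemma acyclic_horn {n : ℕ} (i : Fin (n + 2)) (R : AddSubgroup S) :
    (rel Λ[n + 1, i] (const Δ[n + 1] R)).Acyclic := by
  intro a b c hab hbc f hf hdf
  obtain ⟨hf₁, hf₂⟩ := mem_rel_iff.1 hf
  by_cases hb : b = n + 1
  · subst hb
    obtain rfl : a = n := by omega
    let ι : (Δ[n + 1] : SSet.{0}) _⦋n + 1⦌ := SSet.stdSimplex.objEquiv.symm (𝟙 ⦋n + 1⦌)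
    -- The only nondegenerate simplices outside the horn are the top one and its `i`-th face, so the
    -- relative complex is `R → R` given by the sign of this face. The sign in `r` cancels it.
    let r : S := (-1 : ℤ) ^ (i : ℕ) • f.1 ⟨n + 1, by push_cast; rfl⟩ ι
    have hr : r ∈ R := zsmul_mem (K := R) (hf₂ ⟨n + 1, by push_cast; rfl⟩ ι) _
    let g : normCochains Δ[n + 1] S n := ⟨fun m s =>
      if s ∈ (Δ[n + 1] : SSet.{0}).degenerate m.1 ∨ s ∈ (Λ[n + 1, i]).obj _ then 0 else r,
      fun m s hs => if_pos (.inl hs)⟩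
    have hg : ∀ m s, s ∈ (Λ[n + 1, i]).obj _ → g.1 m s = 0 := fun m s hs => if_pos (.inr hs)
    refine ⟨g, mem_rel_iff.2 ⟨hg, fun m s => ?_⟩, ext_apply fun ⟨m, hm⟩ s => ?_⟩
    · change _root_.ite _ _ _ ∈ R
      split_ifs
      exacts [zero_mem _, hr]
    · obtain rfl : m = n + 1 := by omega
      by_cases hs : s ∈ (Δ[n + 1] : SSet.{0}).degenerate (n + 1)
      · exact ((d _ S hab g).2 _ s hs).trans (f.2 _ s hs).symm
      rw [← SSet.mem_nonDegenerate_iff_notMem_degenerate,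
        SSet.stdSimplex.nonDegenerate_top_dim] at hs
      obtain rfl : s = ι := hs
      change ∑ k : Fin (n + 2), (-1 : ℤ) ^ (k : ℕ) • g.1 ⟨n, rfl⟩ ((Δ[n + 1] : SSet.{0}).δ k ι) = _
      rw [Finset.sum_eq_single i]
      · have : g.1 ⟨n, rfl⟩ ((Δ[n + 1] : SSet.{0}).δ i ι) = r := by
          refine if_neg ?_
          rw [δ_id_eq, SSet.objEquiv_symm_δ_mem_horn_iff]
          rintro (h | h)
          · rw [SSet.mem_degenerate_iff_notMem_nonDegenerate,
              SSet.stdSimplex.objEquiv_symm_mem_nonDegenerate_iff_mono] at h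
            exact h inferInstance
          · exact h rfl
        rw [this, smul_smul, ← mul_pow]
        simp
      · intro k _ hk
        rw [hg ⟨n, rfl⟩ _ (by rw [δ_id_eq, SSet.objEquiv_symm_δ_mem_horn_iff]; exact hk), smul_zero]
      · simp
  -- Outside the top degree a cocycle is zero: in degree `n` its value on the missing face is, up to
  -- sign, its coboundary on the top simplex, and in other degrees there is nothing outside the
  -- horn.
  · refine ⟨0, .zero, ?_⟩
    rw [map_zero]
    refine (eq_zero_of_horn hb hf₁ fun h => ?_).symm
    have := congrFun (congrFun (congrArg Subtype.val hdf) ⟨n + 1, by push_cast; omega⟩)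
      (SSet.stdSimplex.objEquiv.symm (𝟙 ⦋n + 1⦌))
    change ∑ k : Fin (n + 2), (-1 : ℤ) ^ (k : ℕ) • f.1 ⟨n, h⟩ ((Δ[n + 1] : SSet.{0}).δ k _) = 0 at this
    rw [Finset.sum_eq_single i] at this
    · rw [δ_id_eq] at this
      have h' := congrArg ((-1 : ℤ) ^ (i : ℕ) • ·) this
      simp only [smul_smul, ← mul_pow, smul_zero] at h'
      simpa using h'
    · intro k _ hk
      rw [hf₁ ⟨n, h⟩ _ (by rw [δ_id_eq, SSet.objEquiv_symm_δ_mem_horn_iff]; exact hk), smul_zero]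
    · simp

end Coeff

/-! ### Algebras of cochains with coefficients in a system of subrings -/

/-- A system of coefficient rings on a simplicial set `Y`: a subring of `S` for each simplex of `Y`,
such that the subring of a face is contained in that of the simplex. -/
structure RingCoeff (Y : SSet.{0}) (S : Type) [CommRing S] where
  val {n : SimplexCategoryᵒᵖ} : Y.obj n → Subring S
  val_map_le {n m : SimplexCategoryᵒᵖ} (f : n ⟶ m) (y : Y.obj n) : val (Y.map f y) ≤ val y

namespace RingCoeff

variable {X Y : SSet.{0}} {S : Type} [CommRing S]

/-- The pullback of a system of coefficient rings. -/
def comap (g : X ⟶ Y) (ρ : RingCoeff Y S) : RingCoeff X S where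
  val x := ρ.val (g.app _ x)
  val_map_le f x := by
    rw [NatTrans.naturality_apply]
    exact ρ.val_map_le f _

/-- The underlying system of coefficients. -/
def toCoeff (ρ : RingCoeff Y S) : Coeff Y S where
  val y := (ρ.val y).toAddSubgroup
  val_map_le f y := ρ.val_map_le f y

end RingCoeff

namespace DGOperad

variable {E : DGOperad}

/-- A morphism of algebras factors through an injective morphism as soon as it does so elementwise. -/
lemma Alg.exists_factorization {A B C : E.Alg} (ι : B ⟶ C)
    (hι : ∀ q, Function.Injective (ι.hom.f q).hom) (φ : A ⟶ C)
    (h : ∀ q a, ∃ b, (ι.hom.f q).hom b = (φ.hom.f q).hom a) : ∃ ψ : A ⟶ B, ψ ≫ ι = φ := by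
  choose ψ hψ using h
  let Ψ (q : ℤ) : A.cplx.X q →ₗ[ℤ] B.cplx.X q := addMonoidHomToLinearMap
    (.mk' (ψ q) fun a b => hι q (by rw [map_add, hψ, hψ, hψ, map_add]))
  have hΨ (q a) : (ι.hom.f q).hom (Ψ q a) = (φ.hom.f q).hom a := hψ q a
  refine ⟨⟨⟨fun q => ModuleCat.ofHom (Ψ q), fun i j _ => ?_⟩, fun p q r h x a => ?_⟩, ?_⟩
  · refine ModuleCat.hom_ext (LinearMap.ext fun a => hι j ?_)
    refine (ConcreteCategory.congr_hom (ι.hom.comm i j) (Ψ i a)).symm.trans ?_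
    refine (congrArg (C.cplx.d i j).hom (hΨ i a)).trans ?_
    refine (ConcreteCategory.congr_hom (φ.hom.comm i j) a).trans ?_
    exact (hΨ j _).symm
  · refine hι r ((hΨ r _).trans ?_)
    rw [φ.isAlgHom, ι.isAlgHom]
    exact congrArg _ (funext fun j => (hΨ _ _).symm)
  · refine Alg.Hom.ext (HomologicalComplex.hom_ext _ _ fun q => ?_)
    exact ModuleCat.hom_ext (LinearMap.ext fun a => hΨ q a)

end DGOperad

namespace CochainAction

open normCochains

variable {E : DGOperad} (θ : CochainAction E) {S : Type} [CommRing S]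

/-- The algebra `C^*(X; R)`. -/
abbrev C (X : SSet.{0}) (R : Type) [CommRing R] : E.Alg :=
  (θ.cochainAlg.obj (CommRingCat.of R)).obj (op X)

/-- The functoriality of `C^*(X; R)` in both variables. -/
def cmap {X Y : SSet.{0}} {R : Type} [CommRing R] (g : X ⟶ Y) (φ : R →+* S) :
    θ.C Y R ⟶ θ.C X S :=
  ⟨cochainMap g φ, θ.natural g φ⟩

/-- Restriction of cochains. -/
abbrev res {X Y : SSet.{0}} (g : X ⟶ Y) : θ.C Y S ⟶ θ.C X S := θ.cmap g (RingHom.id S)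

/-- The cochain associated to an element by a morphism to an algebra of cochains. -/
def cochain {A : E.Alg} {Y : SSet.{0}} (φ : A ⟶ θ.C Y S) (q : ℤ) (a : A.cplx.X q) :
    normCochains Y S q :=
  (φ.hom.f q).hom a

variable {θ}

lemma hom_ext {A : E.Alg} {Y : SSet.{0}} {φ ψ : A ⟶ θ.C Y S}
    (h : ∀ q a n y, (θ.cochain φ q a).1 n y = (θ.cochain ψ q a).1 n y) : φ = ψ :=
  DGOperad.Alg.Hom.ext (HomologicalComplex.hom_ext _ _ fun q =>
    ModuleCat.hom_ext (LinearMap.ext fun a => ext_apply fun n y => h q a n y))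

lemma cochain_res {A : E.Alg} {X Y : SSet.{0}} (φ : A ⟶ θ.C Y S)
    (g : X ⟶ Y) (q : ℤ) (a : A.cplx.X q) (n) (x : X _⦋n.1⦌) :
    (θ.cochain (φ ≫ θ.res g) q a).1 n x = (θ.cochain φ q a).1 n (g.app _ x) :=
  rfl

/-- Morphisms to algebras of cochains can be glued along a jointly surjective family. -/
lemma exists_glue {A : E.Alg} {Y : SSet.{0}} {J : Type*} {Z : J → SSet.{0}} (f : ∀ j, Z j ⟶ Y)
    (hf : ∀ (n : SimplexCategoryᵒᵖ) (y : Y.obj n), ∃ j z, (f j).app n z = y)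
    (φ : ∀ j, A ⟶ θ.C (Z j) S)
    (h : ∀ j k q a n z z', (f j).app _ z = (f k).app _ z' →
      (θ.cochain (φ j) q a).1 n z = (θ.cochain (φ k) q a).1 n z') :
    ∃ Φ : A ⟶ θ.C Y S, ∀ j, Φ ≫ θ.res (f j) = φ j := by
  choose j₀ z₀ hz₀ using hf
  let F (q : ℤ) (a : A.cplx.X q) : normCochains Y S q :=
    ⟨fun n y => (θ.cochain (φ (j₀ _ y)) q a).1 n (z₀ _ y), fun n y hy => by
      -- The simplex chosen over a degenerate simplex need not be degenerate. By compatibility it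
      -- can be replaced by the degeneration of the simplex chosen over `w`.
      obtain ⟨m, hm, u, w, rfl⟩ := hy
      have hw : (f (j₀ _ w)).app _ ((Z (j₀ _ w)).map u.op (z₀ _ w)) = Y.map u.op w := by
        rw [NatTrans.naturality_apply, hz₀]
      refine (h _ _ q a n _ _ ((hz₀ _ _).trans hw.symm)).trans ?_
      exact (θ.cochain (φ _) q a).2 n _ ⟨m, hm, u, _, rfl⟩⟩
  have hF (j q a) : normCochains.map (f j) (RingHom.id S) q (F q a) = θ.cochain (φ j) q a :=
    ext_apply fun n z => h _ _ q a n _ _ (hz₀ _ _)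
  have hinj (q : ℤ) (u v : normCochains Y S q) (huv : ∀ j,
      normCochains.map (f j) (RingHom.id S) q u = normCochains.map (f j) (RingHom.id S) q v) :
      u = v := by
    refine ext_apply fun n y => ?_
    have := congrFun (congrFun (congrArg Subtype.val (huv (j₀ _ y))) n) (z₀ _ y)
    change u.1 n ((f _).app _ _) = v.1 n ((f _).app _ _) at this
    rwa [hz₀] at this
  let Ψ (q : ℤ) : A.cplx.X q →ₗ[ℤ] (θ.C Y S).cplx.X q := addMonoidHomToLinearMap
    (.mk' (F q) fun a b => hinj q _ _ fun j => by
      refine (hF j q (a + b)).trans ((map_add ((φ j).hom.f q).hom a b).trans ?_)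
      refine (congrArg₂ (· + ·) (hF j q a) (hF j q b)).symm.trans ?_
      exact (map_add (normCochains.map (f j) (RingHom.id S) q) (F q a) (F q b)).symm)
  refine ⟨⟨⟨fun q => ModuleCat.ofHom (Ψ q), fun i k _ => ?_⟩, fun p q r h x a => ?_⟩, fun j => ?_⟩
  · refine ModuleCat.hom_ext (LinearMap.ext fun a => hinj _ _ _ fun j => ?_)
    refine (ConcreteCategory.congr_hom ((θ.res (f j)).hom.comm i k) (F i a)).symm.trans ?_
    refine (congrArg ((θ.C (Z j) S).cplx.d i k).hom (hF j i a)).trans ?_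
    refine (ConcreteCategory.congr_hom ((φ j).hom.comm i k) a).trans ?_
    exact (hF j k _).symm
  · refine hinj _ _ _ fun j => (hF j r _).trans ?_
    refine ((φ j).isAlgHom p q r h x a).trans ?_
    refine Eq.trans ?_ ((θ.res (f j)).isAlgHom p q r h x _).symm
    exact congrArg _ (funext fun i => (hF j _ _).symm)
  · exact hom_ext fun q a n z => congrFun (congrFun (congrArg Subtype.val (hF j q a)) n) z

/-- All cochains in the image of a morphism have coefficients in `ρ`. -/
def Valued {A : E.Alg} {Y : SSet.{0}} (ρ : RingCoeff Y S) (φ : A ⟶ θ.C Y S) : Prop :=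
  ∀ q a, ρ.toCoeff.Mem (θ.cochain φ q a)

variable (θ)

/-- The module of cochains with coefficients in `ρ`. -/
def coeffSubmodule {Y : SSet.{0}} (ρ : RingCoeff Y S) (q : ℤ) :
    Submodule ℤ ((θ.C Y S).cplx.X q) where
  carrier := {f | ρ.toCoeff.Mem (f : normCochains Y S q)}
  add_mem' hf hg := Coeff.Mem.add hf hg
  zero_mem' := Coeff.Mem.zero
  smul_mem' c f hf n y := by
    have := zsmul_mem (hf n y) c
    exact this

lemma d_mem_coeffSubmodule {Y : SSet.{0}} (ρ : RingCoeff Y S) (i j : ℤ) :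
    ∀ f ∈ θ.coeffSubmodule ρ i, ((θ.C Y S).cplx.d i j).hom f ∈ θ.coeffSubmodule ρ j := by
  intro f hf
  by_cases hij : i + 1 = j
  · have : ((θ.C Y S).cplx.d i j) = ModuleCat.ofHom (normCochains.d Y S hij) := dif_pos hij
    rw [this]
    exact Coeff.Mem.d hf hij
  · rw [(θ.C Y S).cplx.shape i j hij]
    exact zero_mem _

/-- The cochains with coefficients in `ρ` are stable under all operations, since the value of an
operation at a simplex can be computed after restriction to this simplex. -/
lemma act_mem_coeffSubmodule {Y : SSet.{0}} (ρ : RingCoeff Y S) {n : ℕ} (p : ℤ) (q : Fin n → ℤ)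
    (r : ℤ) (h : p + ∑ j, q j = r) (x : (E.obj n).X p) (a : ∀ j, (θ.C Y S).cplx.X (q j))
    (ha : ∀ j, a j ∈ θ.coeffSubmodule ρ (q j)) :
    (θ.C Y S).str.act p q r h x a ∈ θ.coeffSubmodule ρ r := by
  intro m y
  let g : Δ[m.1] ⟶ Y := SSet.yonedaEquiv.symm y
  let ι := (ρ.val y).subtype
  have hg {k} (s : (Δ[m.1] : SSet.{0}).obj k) : ρ.val (g.app _ s) ≤ ρ.val y := by
    have : g.app _ s = Y.map (SSet.stdSimplex.objEquiv s).op y := rfl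
    rw [this]
    exact ρ.val_map_le _ y
  -- Every simplex of `Δ[m]` maps to a simplex obtained from `y`, so the restricted arguments come
  -- from cochains over the ring `ρ.val y`. Naturality along `g` and along the inclusion of this
  -- ring puts the value at `y` in it.
  let b (j : Fin n) : normCochains Δ[m.1] (ρ.val y) (q j) :=
    ⟨fun k s => ⟨(a j).1 k (g.app _ s), hg s (ha j k _)⟩, fun k s hs =>
      Subtype.ext ((a j).2 k _ (SSet.degenerate_app_apply hs g))⟩
  have h₁ := (θ.res (S := S) g).isAlgHom p q r h x a
  have h₂ := (θ.cmap (𝟙 Δ[m.1]) ι).isAlgHom p q r h x b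
  have h₃ := h₁.trans (show _ = _ from h₂.symm)
  have h₄ := congrFun (congrFun (congrArg Subtype.val h₃) m) (SSet.stdSimplex.objEquiv.symm (𝟙 _))
  have h₅ : g.app _ (SSet.stdSimplex.objEquiv.symm (𝟙 _)) = y :=
    SSet.yonedaEquiv.apply_symm_apply y
  have h₆ : ((θ.C Y S).str.act p q r h x a).1 m (g.app _ (SSet.stdSimplex.objEquiv.symm (𝟙 _))) ∈
      ρ.val y := by
    refine Eq.subst (motive := (· ∈ ρ.val y)) h₄.symm ?_
    exact Subtype.property _
  rwa [h₅] at h₆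

/-- The algebra of cochains with coefficients in `ρ`. -/
def coeffAlg {Y : SSet.{0}} (ρ : RingCoeff Y S) : E.Alg :=
  ⟨subCplx _ (θ.coeffSubmodule ρ) (θ.d_mem_coeffSubmodule ρ),
    (θ.C Y S).str.restrict _ _ (θ.act_mem_coeffSubmodule ρ)⟩

/-- The inclusion of the cochains with coefficients in `ρ`. -/
def coeffAlgι {Y : SSet.{0}} (ρ : RingCoeff Y S) : θ.coeffAlg ρ ⟶ θ.C Y S :=
  ⟨subCplxι _ _ _, fun _ _ _ _ _ _ => rfl⟩

lemma coeffAlgι_injective {Y : SSet.{0}} (ρ : RingCoeff Y S) (q : ℤ) :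
    Function.Injective ((θ.coeffAlgι ρ).hom.f q).hom :=
  Subtype.val_injective

/-- Restriction of cochains with coefficients. -/
def coeffRes {X Y : SSet.{0}} (g : X ⟶ Y) (ρ : RingCoeff Y S) :
    θ.coeffAlg ρ ⟶ θ.coeffAlg (ρ.comap g) :=
  (DGOperad.Alg.exists_factorization (θ.coeffAlgι (ρ.comap g)) (θ.coeffAlgι_injective _)
    (θ.coeffAlgι ρ ≫ θ.res g) fun q f => ⟨⟨normCochains.map g (RingHom.id S) q f.1,
      fun n x => f.2 n (g.app _ x)⟩, rfl⟩).choose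

lemma coeffRes_ι {X Y : SSet.{0}} (g : X ⟶ Y) (ρ : RingCoeff Y S) :
    θ.coeffRes g ρ ≫ θ.coeffAlgι (ρ.comap g) = θ.coeffAlgι ρ ≫ θ.res g :=
  (DGOperad.Alg.exists_factorization (θ.coeffAlgι (ρ.comap g)) (θ.coeffAlgι_injective _)
    (θ.coeffAlgι ρ ≫ θ.res g) fun q f => ⟨⟨normCochains.map g (RingHom.id S) q f.1,
      fun n x => f.2 n (g.app _ x)⟩, rfl⟩).choose_spec

end CochainAction

/-! ### Extension of morphisms from a cofibrant algebra -/

namespace CochainAction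

open normCochains

variable {E : DGOperad} {θ : CochainAction E} {S : Type} [CommRing S]

lemma coeffRes_val {X Y : SSet.{0}} (g : X ⟶ Y) (ρ : RingCoeff Y S) (q : ℤ)
    (f : (θ.coeffAlg ρ).cplx.X q) :
    (((θ.coeffRes g ρ).hom.f q).hom f).1 = normCochains.map g (RingHom.id S) q f.1 :=
  ConcreteCategory.congr_hom (HomologicalComplex.congr_hom
    (congrArg DGOperad.Alg.Hom.hom (θ.coeffRes_ι g ρ)) q) f

lemma coeffAlg_d_val {Y : SSet.{0}} (ρ : RingCoeff Y S) {i j : ℤ} (hij : i + 1 = j)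
    (f : (θ.coeffAlg ρ).cplx.X i) :
    (((θ.coeffAlg ρ).cplx.d i j).hom f).1 = normCochains.d Y S hij f.1 := by
  have : ((θ.C Y S).cplx.d i j) = ModuleCat.ofHom (normCochains.d Y S hij) := dif_pos hij
  exact ConcreteCategory.congr_hom this f.1

-- Extension by zero keeps the coefficients, and stays normalized because a simplex of `B` that is
-- degenerate in `Y` is degenerate in `B`.
open Classical in
lemma coeffRes_surjective {Y : SSet.{0}} (B : Y.Subcomplex) (ρ : RingCoeff Y S) (q : ℤ) :
    Function.Surjective ((θ.coeffRes B.ι ρ).hom.f q).hom := by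
  intro f
  let f' : normCochains (B : SSet.{0}) S q := f.1
  have hf' : (ρ.comap B.ι).toCoeff.Mem f' := f.2
  let F : normCochains Y S q := ⟨fun n y => if h : y ∈ B.obj _ then f'.1 n ⟨y, h⟩ else 0, by
    intro n y hy
    by_cases h : y ∈ B.obj _
    · refine (dif_pos h).trans (f'.2 n ⟨y, h⟩ ?_)
      exact (SSet.Subcomplex.mem_degenerate_iff _ ⟨y, h⟩).2 hy
    · exact dif_neg h⟩
  have hF : ρ.toCoeff.Mem F := by
    intro n y
    change dite _ _ _ ∈ ρ.toCoeff.val y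
    split_ifs with h
    · exact hf' n ⟨y, h⟩
    · exact zero_mem _
  refine ⟨⟨F, hF⟩, Subtype.ext ?_⟩
  refine (coeffRes_val B.ι ρ q ⟨F, hF⟩).trans (ext_apply fun n y => ?_)
  exact dif_pos y.2

/-- The kernel of the restriction is the complex of cochains relative to `B`. -/
lemma coeffRes_quasiIso {Y : SSet.{0}} (B : Y.Subcomplex) (ρ : RingCoeff Y S)
    (h : (Coeff.rel B ρ.toCoeff).Acyclic) : QuasiIso (θ.coeffRes B.ι ρ).hom := by
  refine quasiIso_of_surjective _ (coeffRes_surjective B ρ) fun i j k hij hjk b hb hdb => ?_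
  have hb' (q : ℤ) (b : (θ.coeffAlg ρ).cplx.X q) :
      ((θ.coeffRes B.ι ρ).hom.f q).hom b = 0 ↔ (Coeff.rel B ρ.toCoeff).Mem b.1 := by
    refine Iff.trans ?_ Coeff.mem_rel_iff.symm
    constructor
    · intro hb
      have hb₁ := (coeffRes_val B.ι ρ q b).symm.trans (congrArg Subtype.val hb)
      exact ⟨fun n y hy => congrFun (congrFun (congrArg Subtype.val hb₁) n) ⟨y, hy⟩, b.2⟩
    · intro hb
      exact Subtype.ext ((coeffRes_val B.ι ρ q b).trans
        (ext_apply fun n y => hb.1 n (B.ι.app _ y) y.2))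
  obtain ⟨g, hg, hgb⟩ := h i j k hij hjk b.1 ((hb' j b).1 hb)
    ((coeffAlg_d_val ρ hjk b).symm.trans (congrArg Subtype.val hdb))
  refine ⟨⟨g, (Coeff.mem_rel_iff.1 hg).2⟩, (hb' i _).2 hg, Subtype.ext ?_⟩
  exact (coeffAlg_d_val ρ hij _).trans hgb

/-- A compatible family of morphisms from a cofibrant algebra extends if the relative cochains
form an acyclic complex. -/
lemma exists_extension {A : E.Alg} (hA : A.IsCofibrant) {Y : SSet.{0}} (ρ : RingCoeff Y S)
    {J : Type*} {Z : J → SSet.{0}} (f : ∀ j, Z j ⟶ Y) (φ : ∀ j, A ⟶ θ.C (Z j) S)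
    (hφ : ∀ j, Valued (ρ.comap (f j)) (φ j))
    (h : ∀ j k q a n z z', (f j).app _ z = (f k).app _ z' →
      (θ.cochain (φ j) q a).1 n z = (θ.cochain (φ k) q a).1 n z')
    (B : Y.Subcomplex) (hB : ∀ n (y : Y.obj n), y ∈ B.obj n ↔ ∃ j z, (f j).app n z = y)
    (hac : (Coeff.rel B ρ.toCoeff).Acyclic) :
    ∃ Φ : A ⟶ θ.C Y S, Valued ρ Φ ∧ ∀ j, Φ ≫ θ.res (f j) = φ j := by
  have hr (j : J) : SSet.Subcomplex.range (f j) ≤ B := by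
    rintro n _ ⟨z, rfl⟩
    exact (hB n _).2 ⟨j, z, rfl⟩
  obtain ⟨φ', hφ'⟩ := exists_glue (θ := θ) (fun j => SSet.Subcomplex.lift (f j) (hr j))
    (by
      rintro n ⟨y, hy⟩
      obtain ⟨j, z, hz⟩ := (hB n y).1 hy
      exact ⟨j, z, Subtype.ext hz⟩) φ
    fun j k q a n z z' hz => h j k q a n z z' (congrArg Subtype.val hz)
  have hv : Valued (ρ.comap B.ι) φ' := by
    rintro q a n ⟨y, hy⟩
    obtain ⟨j, z, rfl⟩ := (hB _ y).1 hy
    have := hφ j q a n z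
    rw [← hφ' j] at this
    exact this
  obtain ⟨ψ, hψ⟩ := DGOperad.Alg.exists_factorization (θ.coeffAlgι (ρ.comap B.ι))
    (θ.coeffAlgι_injective _) φ' fun q a => ⟨⟨_, hv q a⟩, rfl⟩
  -- Cofibrancy of `A`: the glued map on `B` lifts along the surjective quasi-isomorphism from the
  -- cochains on `Y`.
  obtain ⟨Ψ, hΨ⟩ := hA _ _ (θ.coeffRes B.ι ρ) (coeffRes_surjective B ρ)
    (coeffRes_quasiIso B ρ hac) ψ
  refine ⟨Ψ ≫ θ.coeffAlgι ρ, fun q a => ((Ψ.hom.f q).hom a).2, fun j => ?_⟩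
  have h₁ : (Ψ ≫ θ.coeffAlgι ρ) ≫ θ.res B.ι = φ' := by
    rw [Category.assoc, ← coeffRes_ι, ← Category.assoc, hΨ, hψ]
  rw [← hφ' j, ← h₁]
  rfl

end CochainAction

/-! ### Mapping spaces -/

namespace CochainAction

open normCochains MonoidalCategory CartesianMonoidalCategory

variable {E : DGOperad} (θ : CochainAction E) (A : E.Alg) {S : Type} [CommRing S]

variable {θ A} in
lemma Valued.res {X Y : SSet.{0}} {ρ : RingCoeff Y S} {ρ' : RingCoeff X S} {φ : A ⟶ θ.C Y S}
    (hφ : Valued ρ φ) (g : X ⟶ Y)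
    (h : ∀ {n : SimplexCategoryᵒᵖ} (x : X.obj n), ρ.val (g.app n x) ≤ ρ'.val x) :
    Valued ρ' (φ ≫ θ.res g) :=
  fun q a n x => h x (hφ q a n (g.app _ x))

/-- The simplicial set of morphisms from `A` to the cochains on `Δ[n] ⊗ K` with coefficients
which are pulled back from `K`. -/
def mapping (K : SSet.{0}) (ρ : RingCoeff K S) : SSet.{0} where
  obj n := {φ : A ⟶ θ.C (SSet.stdSimplex.obj n.unop ⊗ K) S // Valued (ρ.comap (snd _ _)) φ}
  map f := ↾fun φ => ⟨φ.1 ≫ θ.res (SSet.stdSimplex.map f.unop ▷ K), φ.2.res _ fun _ => le_rfl⟩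
  map_id n := by
    ext φ
    have : SSet.stdSimplex.map (𝟙 n.unop) ▷ K = 𝟙 _ :=
      (congrArg (· ▷ K) (SSet.stdSimplex.map_id _)).trans (id_whiskerRight _ _)
    exact congrArg (fun g => φ.1 ≫ θ.res g) this
  map_comp f g := by
    ext φ
    have : SSet.stdSimplex.map (g.unop ≫ f.unop) ▷ K =
      SSet.stdSimplex.map g.unop ▷ K ≫ SSet.stdSimplex.map f.unop ▷ K :=
      (congrArg (· ▷ K) (SSet.stdSimplex.map_comp _ _)).trans (comp_whiskerRight _ _ _)
    exact congrArg (fun g => φ.1 ≫ θ.res g) this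

variable {θ A}

lemma mapping_ext {K : SSet.{0}} {ρ : RingCoeff K S} {n : SimplexCategoryᵒᵖ}
    {φ ψ : (θ.mapping A K ρ).obj n}
    (h : ∀ q a m y, (θ.cochain φ.1 q a).1 m y = (θ.cochain ψ.1 q a).1 m y) : φ = ψ :=
  Subtype.ext (hom_ext h)

/-- The functoriality of mapping spaces. -/
def mappingMap {K L : SSet.{0}} {ρ : RingCoeff K S} {ρ' : RingCoeff L S} (g : L ⟶ K)
    (h : ∀ {n : SimplexCategoryᵒᵖ} (l : L.obj n), ρ.val (g.app n l) ≤ ρ'.val l) :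
    θ.mapping A K ρ ⟶ θ.mapping A L ρ' where
  app _ := ↾fun φ => ⟨φ.1 ≫ θ.res (_ ◁ g), φ.2.res _ fun y => h y.2⟩
  naturality _ _ _ := rfl

variable {K : SSet.{0}} {ρ : RingCoeff K S} {X : SSet.{0}}

/-- The morphism to a mapping space given by a morphism to an algebra of cochains. -/
def curry (ψ : A ⟶ θ.C (X ⊗ K) S) (hψ : Valued (ρ.comap (snd X K)) ψ) : X ⟶ θ.mapping A K ρ where
  app n := ↾fun x => ⟨ψ ≫ θ.res (SSet.yonedaEquiv.symm x ▷ K), hψ.res _ fun _ => le_rfl⟩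
  naturality n m f := by
    ext x
    have := SSet.yonedaEquiv_symm_naturality_left f.unop x
    refine mapping_ext fun q a l y => congrArg ((θ.cochain ψ q a).1 l) (Prod.ext ?_ rfl)
    exact ConcreteCategory.congr_hom (NatTrans.congr_app this.symm _) y.1

/-- By naturality of `u`, a morphism to a mapping space is determined by its values at pairs whose
first component is a fundamental simplex. This gives the adjunction between `curry` and `uncurry`.
-/
lemma cochain_app_eq (u : X ⟶ θ.mapping A K ρ) {n : SimplexCategoryᵒᵖ} (x : X.obj n) (q : ℤ)
    (a : A.cplx.X q) (m) (y : (SSet.stdSimplex.obj n.unop ⊗ K) _⦋m.1⦌) :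
    (θ.cochain (u.app n x).1 q a).1 m y = (θ.cochain (u.app (op ⦋m.1⦌)
      ((SSet.yonedaEquiv.symm x : SSet.stdSimplex.obj n.unop ⟶ X).app _ y.1)).1 q a).1 m
        (SSet.stdSimplex.objEquiv.symm (𝟙 _), y.2) := by
  obtain ⟨s, k⟩ := y
  obtain ⟨f, rfl⟩ := SSet.stdSimplex.objEquiv.symm.surjective s
  have h : (SSet.yonedaEquiv.symm x : SSet.stdSimplex.obj n.unop ⟶ X).app (op ⦋m.1⦌)
    (SSet.stdSimplex.objEquiv.symm f) = X.map f.op x := rfl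
  have h' : u.app _ (X.map f.op x) = (θ.mapping A K ρ).map f.op (u.app _ x) :=
    NatTrans.naturality_apply u f.op x
  rw [h, h']
  refine congrArg ((θ.cochain (u.app n x).1 q a).1 m) (Prod.ext ?_ rfl)
  apply SSet.stdSimplex.objEquiv.injective
  exact (Category.id_comp f).symm

/-- The products of `K` with the simplices of `X` cover `X ⊗ K`, and `cochain_app_eq` shows that the
given maps agree on overlaps. -/
lemma exists_uncurry (u : X ⟶ θ.mapping A K ρ) : ∃ ψ : A ⟶ θ.C (X ⊗ K) S,
    ∀ q a m (y : (X ⊗ K) _⦋m.1⦌), (θ.cochain ψ q a).1 m y =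
      (θ.cochain (u.app _ y.1).1 q a).1 m (SSet.stdSimplex.objEquiv.symm (𝟙 _), y.2) := by
  have hid {n : SimplexCategoryᵒᵖ} (x : X.obj n) :
      (SSet.yonedaEquiv.symm x : SSet.stdSimplex.obj n.unop ⟶ X).app n
        (SSet.stdSimplex.objEquiv.symm (𝟙 _)) = x := SSet.yonedaEquiv.apply_symm_apply x
  obtain ⟨ψ, hψ⟩ := exists_glue (θ := θ) (A := A) (S := S) (Y := X ⊗ K)
    (J := Σ n : SimplexCategoryᵒᵖ, X.obj n)
    (Z := fun j => SSet.stdSimplex.obj j.1.unop ⊗ K)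
    (fun j => (SSet.yonedaEquiv.symm j.2 : SSet.stdSimplex.obj j.1.unop ⟶ X) ▷ K)
    (fun n y => ⟨⟨n, y.1⟩, (SSet.stdSimplex.objEquiv.symm (𝟙 _), y.2), Prod.ext (hid y.1) rfl⟩)
    (fun j => (u.app j.1 j.2).1) (fun j k q a n z z' hz => by
      rw [cochain_app_eq, cochain_app_eq]
      have h₁ := congrArg Prod.fst hz
      have h₂ := congrArg Prod.snd hz
      change (SSet.yonedaEquiv.symm j.2 : SSet.stdSimplex.obj j.1.unop ⟶ X).app _ z.1 =
        (SSet.yonedaEquiv.symm k.2 : SSet.stdSimplex.obj k.1.unop ⟶ X).app _ z'.1 at h₁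
      change z.2 = z'.2 at h₂
      rw [h₁, h₂])
  refine ⟨ψ, fun q a m y => ?_⟩
  rw [← hψ ⟨op ⦋m.1⦌, y.1⟩]
  exact congrArg ((θ.cochain ψ q a).1 m) (Prod.ext (hid y.1).symm rfl)

/-- The morphism to an algebra of cochains given by a morphism to a mapping space. -/
def uncurry (u : X ⟶ θ.mapping A K ρ) : A ⟶ θ.C (X ⊗ K) S := (exists_uncurry u).choose

lemma cochain_uncurry (u : X ⟶ θ.mapping A K ρ) (q a m) (y : (X ⊗ K) _⦋m.1⦌) :
    (θ.cochain (uncurry u) q a).1 m y =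
      (θ.cochain (u.app _ y.1).1 q a).1 m (SSet.stdSimplex.objEquiv.symm (𝟙 _), y.2) :=
  (exists_uncurry u).choose_spec q a m y

lemma valued_uncurry (u : X ⟶ θ.mapping A K ρ) : Valued (ρ.comap (snd X K)) (uncurry u) := by
  intro q a m y
  rw [cochain_uncurry]
  exact (u.app _ y.1).2 q a m (SSet.stdSimplex.objEquiv.symm (𝟙 _), y.2)

lemma uncurry_injective {u v : X ⟶ θ.mapping A K ρ} (h : uncurry u = uncurry v) : u = v := by
  ext n x
  refine mapping_ext fun q a m y => ?_
  refine (cochain_app_eq u x q a m y).trans (Eq.trans ?_ (cochain_app_eq v x q a m y).symm)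
  refine (cochain_uncurry u q a m (_, y.2)).symm.trans ?_
  rw [h]
  exact cochain_uncurry v q a m (_, y.2)

lemma uncurry_curry (ψ : A ⟶ θ.C (X ⊗ K) S) (hψ : Valued (ρ.comap (snd X K)) ψ) :
    uncurry (curry ψ hψ) = ψ := by
  refine hom_ext fun q a m y => ?_
  rw [cochain_uncurry]
  exact congrArg ((θ.cochain ψ q a).1 m) (Prod.ext (SSet.yonedaEquiv.apply_symm_apply y.1) rfl)

lemma uncurry_comp {X' : SSet.{0}} (i : X' ⟶ X) (u : X ⟶ θ.mapping A K ρ) :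
    uncurry (i ≫ u) = uncurry u ≫ θ.res (i ▷ K) := by
  refine hom_ext fun q a m y => ?_
  rw [cochain_uncurry, cochain_res, cochain_uncurry]
  rfl

lemma uncurry_comp_mappingMap {L : SSet.{0}} {ρ' : RingCoeff L S} (g : L ⟶ K)
    (h : ∀ {n : SimplexCategoryᵒᵖ} (l : L.obj n), ρ.val (g.app n l) ≤ ρ'.val l)
    (u : X ⟶ θ.mapping A K ρ) :
    uncurry (u ≫ mappingMap g h) = uncurry u ≫ θ.res (X ◁ g) := by
  refine hom_ext fun q a m y => ?_
  rw [cochain_uncurry, cochain_res, cochain_uncurry]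
  rfl

/-- A criterion for the existence of lifts to a mapping space. -/
lemma exists_lift (hA : A.IsCofibrant) {X' : SSet.{0}} (i : X' ⟶ X) [Mono i]
    (u₀ : X' ⟶ θ.mapping A K ρ) {J : Type*} {L : J → SSet.{0}} (g : ∀ j, L j ⟶ K)
    (ρ' : ∀ j, RingCoeff (L j) S)
    (hle : ∀ j {n : SimplexCategoryᵒᵖ} (l : (L j).obj n), ρ.val ((g j).app n l) ≤ (ρ' j).val l)
    (hge : ∀ j {n : SimplexCategoryᵒᵖ} (l : (L j).obj n), (ρ' j).val l ≤ ρ.val ((g j).app n l))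
    (v : ∀ j, X ⟶ θ.mapping A (L j) (ρ' j))
    (h₁ : ∀ j, i ≫ v j = u₀ ≫ mappingMap (g j) (hle j))
    (h₂ : ∀ j j' {n : SimplexCategoryᵒᵖ} (l : (L j).obj n) (l' : (L j').obj n),
      (g j).app n l = (g j').app n l' → ∃ (F : SSet.{0}) (f : F ⟶ L j) (f' : F ⟶ L j')
        (l₀ : F.obj n) (ρF : RingCoeff F S)
        (hf : ∀ {n : SimplexCategoryᵒᵖ} (l : F.obj n), (ρ' j).val (f.app n l) ≤ ρF.val l)
        (hf' : ∀ {n : SimplexCategoryᵒᵖ} (l : F.obj n), (ρ' j').val (f'.app n l) ≤ ρF.val l),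
        f.app n l₀ = l ∧ f'.app n l₀ = l' ∧ v j ≫ mappingMap f hf = v j' ≫ mappingMap f' hf')
    (B : (X ⊗ K).Subcomplex) (hB : ∀ {n : SimplexCategoryᵒᵖ} (y : (X ⊗ K).obj n), y ∈ B.obj n ↔
      (∃ x', i.app n x' = y.1) ∨ ∃ j l, (g j).app n l = y.2)
    (hac : (Coeff.rel B (ρ.comap (snd X K)).toCoeff).Acyclic) :
    ∃ u : X ⟶ θ.mapping A K ρ, i ≫ u = u₀ ∧ ∀ j, u ≫ mappingMap (g j) (hle j) = v j := by
  -- A lift amounts to an extension to `X ⊗ K` from the union of `X' ⊗ K` (index `none`) and the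
  -- images of the `X ⊗ L j` (index `some j`). The hypotheses `h₁` and `h₂` give agreement on
  -- overlaps.
  let Z : Option J → SSet.{0} := fun o => match o with
    | none => X' ⊗ K
    | some j => X ⊗ L j
  let f (o : Option J) : Z o ⟶ X ⊗ K := match o with
    | none => i ▷ K
    | some j => X ◁ g j
  let φ (o : Option J) : A ⟶ θ.C (Z o) S := match o with
    | none => uncurry u₀
    | some j => uncurry (v j)
  have h₀ (j : J) : uncurry (v j) ≫ θ.res (i ▷ L j) = uncurry u₀ ≫ θ.res (X' ◁ g j) := by
    rw [← uncurry_comp, h₁, uncurry_comp_mappingMap]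
  have key (j : J) (q a n) (z : (X' ⊗ K : SSet.{0}) _⦋n.1⦌) (z' : (X ⊗ L j : SSet.{0}) _⦋n.1⦌)
      (hz : (i ▷ K).app _ z = (X ◁ g j).app _ z') :
      (θ.cochain (uncurry u₀) q a).1 n z = (θ.cochain (uncurry (v j)) q a).1 n z' := by
    have := congrArg (fun w => (θ.cochain w q a).1 n (z.1, z'.2)) (h₀ j)
    have e₁ : i.app _ z.1 = z'.1 := congrArg Prod.fst hz
    have e₂ : z.2 = (g j).app _ z'.2 := congrArg Prod.snd hz
    refine Eq.trans ?_ (this.symm.trans ?_)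
    · exact congrArg ((θ.cochain (uncurry u₀) q a).1 n) (Prod.ext rfl e₂)
    · exact congrArg ((θ.cochain (uncurry (v j)) q a).1 n) (Prod.ext e₁ rfl)
  obtain ⟨Φ, hΦ, hΦ'⟩ := exists_extension hA (ρ.comap (snd X K)) f φ (by
      rintro (_ | j) q a n y
      · exact valued_uncurry u₀ q a n y
      · exact hge j _ (valued_uncurry (v j) q a n y)) (by
      rintro (_ | j) (_ | j') q a n z z' hz
      · have hz' : (i ▷ K).app _ z = (i ▷ K).app _ z' := hz
        have e₁ : i.app _ z.1 = i.app _ z'.1 := congrArg Prod.fst hz'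
        have e₂ : ((i ▷ K).app _ z).2 = ((i ▷ K).app _ z').2 := congrArg Prod.snd hz'
        have hi : Function.Injective (i.app (op ⦋n.1⦌)) :=
          (mono_iff_injective _).1 inferInstance
        exact congrArg ((θ.cochain (uncurry u₀) q a).1 n) (Prod.ext (hi e₁) e₂)
      · exact key j' q a n z z' hz
      · exact (key j q a n z' z hz.symm).symm
      · have hz' : (X ◁ g j).app _ z = (X ◁ g j').app _ z' := hz
        have e₁ : z.1 = z'.1 := congrArg Prod.fst hz'
        have e₂ : (g j).app _ z.2 = (g j').app _ z'.2 := congrArg Prod.snd hz'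
        -- Two simplices with the same image in `K` come from one simplex of `F`, over which the two
        -- data agree.
        obtain ⟨F, f, f', l₀, ρF, hf, hf', hl, hl', hv⟩ := h₂ j j' z.2 z'.2 e₂
        have h₃ := congrArg uncurry hv
        rw [uncurry_comp_mappingMap, uncurry_comp_mappingMap] at h₃
        have := congrArg (fun w => (θ.cochain w q a).1 n (z.1, l₀)) h₃
        refine Eq.trans ?_ (this.trans ?_)
        · exact congrArg ((θ.cochain (uncurry (v j)) q a).1 n) (Prod.ext rfl hl.symm)
        · exact congrArg ((θ.cochain (uncurry (v j')) q a).1 n) (Prod.ext e₁ hl')) B (by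
      intro n y
      rw [hB]
      constructor
      · rintro (⟨x', hx'⟩ | ⟨j, l, hl⟩)
        · exact ⟨none, (x', y.2), Prod.ext hx' rfl⟩
        · exact ⟨some j, (y.1, l), Prod.ext rfl hl⟩
      · rintro ⟨_ | j, z, rfl⟩
        · exact .inl ⟨z.1, rfl⟩
        · exact .inr ⟨j, z.2, rfl⟩) hac
  refine ⟨curry Φ hΦ, uncurry_injective ?_, fun j => uncurry_injective ?_⟩
  · rw [uncurry_comp, uncurry_curry]
    exact hΦ' none
  · rw [uncurry_comp_mappingMap, uncurry_curry]
    exact hΦ' (some j)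

end CochainAction

/-! ### Weak equivalences -/

section

open MonoidalCategory CartesianMonoidalCategory

/-- The constant homotopy. -/
def SSet.Homotopy.refl' {X Y : SSet.{0}} (f : X ⟶ Y) : SSet.Homotopy f f :=
  .mk' (fst X Δ[1] ≫ f) rfl rfl

lemma HomotopyClasses.precomp_precomp {X Y K : SSet.{0}} {f : X ⟶ Y} {g : Y ⟶ X}
    (h : SSet.Homotopy (f ≫ g) (𝟙 X)) (c : HomotopyClasses X K) :
    precomp f K (precomp g K c) = c := by
  obtain ⟨v, rfl⟩ := Quot.exists_rep c
  refine Quot.sound ⟨.mk' (h.h ≫ v) ?_ ?_⟩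
  · rw [← Category.assoc, h.h₀, Category.assoc]
  · rw [← Category.assoc, h.h₁, Category.id_comp]

lemma isWeakEquivalence_of_homotopy {X Y : SSet.{0}} {f : X ⟶ Y} {g : Y ⟶ X}
    (h₁ : SSet.Homotopy (f ≫ g) (𝟙 X)) (h₂ : SSet.Homotopy (g ≫ f) (𝟙 Y)) :
    IsWeakEquivalence f := fun K _ =>
  Function.bijective_iff_has_inverse.2 ⟨HomotopyClasses.precomp g K,
    HomotopyClasses.precomp_precomp h₂, HomotopyClasses.precomp_precomp h₁⟩

lemma IsWeakEquivalence.comp {X Y Z : SSet.{0}} {f : X ⟶ Y} {g : Y ⟶ Z}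
    (hf : IsWeakEquivalence f) (hg : IsWeakEquivalence g) : IsWeakEquivalence (f ≫ g) := by
  intro K _
  convert (hf K).comp (hg K) using 1
  funext c
  obtain ⟨v, rfl⟩ := Quot.exists_rep c
  exact congrArg (Quot.mk _) (Category.assoc f g v)

open Classical in
/-- The morphism on the ends of a cylinder which is `f` at the end `0` and `g` at the end `1`. -/
def cylinderEndsDesc {W Z : SSet.{0}} (f g : W ⟶ Z) :
    ((cylinderEnd W 0 ⊔ cylinderEnd W 1 : (W ⊗ Δ[1] : SSet.{0}).Subcomplex) : SSet.{0}) ⟶ Z where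
  app n := ↾fun y => if y.1 ∈ (cylinderEnd W 0).obj n then f.app n y.1.1 else g.app n y.1.1
  naturality n m a := by
    ext y
    obtain ⟨y, hy⟩ := y
    by_cases h : y ∈ (cylinderEnd W 0).obj n
    · refine (if_pos ((cylinderEnd W 0).map a h)).trans ?_
      refine Eq.trans ?_ (congrArg (Z.map a) (if_pos h)).symm
      exact NatTrans.naturality_apply f a y.1
    · have h₁ : y ∈ (cylinderEnd W 1).obj n := hy.resolve_left h
      refine (if_neg fun h₀ => cylinderEnd_disjoint h₀ ((cylinderEnd W 1).map a h₁)).trans ?_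
      refine Eq.trans ?_ (congrArg (Z.map a) (if_neg h)).symm
      exact NatTrans.naturality_apply g a y.1

/-- A morphism with the right lifting property with respect to all monomorphisms is a weak
equivalence. -/
lemma isWeakEquivalence_of_rlp {W P : SSet.{0}} (π : W ⟶ P)
    (h : ∀ {X' X : SSet.{0}} (i : X' ⟶ X) [Mono i], HasLiftingProperty i π) :
    IsWeakEquivalence π := by
  have := h (⊥ : P.Subcomplex).ι
  -- Lifting against the inclusion of the empty simplicial set gives a section `s`. Lifting against
  -- the ends of the cylinder, over the constant homotopy of `π`, deforms `π ≫ s` to the identity.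
  have sq₁ : CommSq (SSet.Subcomplex.isInitialBot.to W) (⊥ : P.Subcomplex).ι π (𝟙 P) :=
    ⟨SSet.Subcomplex.isInitialBot.hom_ext _ _⟩
  let s := sq₁.lift
  have hs : s ≫ π = 𝟙 P := sq₁.fac_right
  let B : (W ⊗ Δ[1] : SSet.{0}).Subcomplex := cylinderEnd W 0 ⊔ cylinderEnd W 1
  have := h B.ι
  have sq₂ : CommSq (cylinderEndsDesc (π ≫ s) (𝟙 W)) B.ι π (fst W Δ[1] ≫ π) := ⟨by
    ext n ⟨y, hy⟩
    by_cases h : y ∈ (cylinderEnd W 0).obj n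
    · refine (congrArg (π.app n) (if_pos h)).trans ?_
      exact ConcreteCategory.congr_hom (NatTrans.congr_app hs n) (π.app n y.1)
    · exact congrArg (π.app n) (if_neg h)⟩
  refine isWeakEquivalence_of_homotopy (g := s) (.mk' sq₂.lift ?_ ?_) (hs ▸ .refl' _)
  · ext n x
    have hx := ι₀_mem_cylinderEnd x
    refine (ConcreteCategory.congr_hom (NatTrans.congr_app sq₂.fac_left n)
      ⟨SSet.ι₀.app n x, .inl hx⟩).trans ?_
    exact if_pos hx
  · ext n x
    have hx := ι₁_mem_cylinderEnd x
    refine (ConcreteCategory.congr_hom (NatTrans.congr_app sq₂.fac_left n)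
      ⟨SSet.ι₁.app n x, .inr hx⟩).trans ?_
    exact if_neg fun h₀ => cylinderEnd_disjoint h₀ hx

end

/-! ### Comparison of T(A; R) with mapping spaces over contractible K -/

namespace CochainAction

open normCochains MonoidalCategory CartesianMonoidalCategory

variable {E : DGOperad} {θ : CochainAction E} {A : E.Alg} {S : Type} [CommRing S]
  {K : SSet.{0}} {ρ : RingCoeff K S} {R : Type} [CommRing R]

/-- The morphism from `T(A; R)` to a mapping space with coefficients which contain the image
of `R`. -/
def toMapping (φ : R →+* S) (h : ∀ {n : SimplexCategoryᵒᵖ} (k : K.obj n), φ.range ≤ ρ.val k) :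
    (θ.T A).obj (CommRingCat.of R) ⟶ θ.mapping A K ρ where
  app n := ↾fun (ψ : A ⟶ θ.C (SSet.stdSimplex.obj n.unop) R) =>
    ⟨ψ ≫ θ.cmap (fst _ K) φ, fun _ _ _ y => h y.2 ⟨_, rfl⟩⟩
  naturality _ _ _ := rfl

lemma cmap_injective {φ : R →+* S} (hφ : Function.Injective φ) (X : SSet.{0}) (q : ℤ) :
    Function.Injective ((θ.cmap (𝟙 X) φ).hom.f q).hom := fun _ _ hfg =>
  ext_apply fun n x => hφ (congrFun (congrFun (congrArg Subtype.val hfg) n) x)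

lemma comp_cmap_injective {φ : R →+* S} (hφ : Function.Injective φ) {X : SSet.{0}}
    {ψ ψ' : A ⟶ θ.C X R} (h : ψ ≫ θ.cmap (𝟙 X) φ = ψ' ≫ θ.cmap (𝟙 X) φ) : ψ = ψ' :=
  hom_ext fun q a n x => hφ (congrArg (fun w => (θ.cochain w q a).1 n x) h)

/-- At the vertex `k₀` the coefficients are exactly the image of `R`, so after restriction to this
vertex a map takes values in cochains over `R`. -/
lemma exists_ofMapping {φ : R →+* S} (hφ : Function.Injective φ) (k₀ : K _⦋0⦌)
    (hk₀ : ∀ {n : SimplexCategoryᵒᵖ} (k : K.obj n),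
      ρ.val ((SSet.const k₀ : K ⟶ K).app n k) = φ.range)
    {n : SimplexCategoryᵒᵖ} (u : (θ.mapping A K ρ).obj n) :
    ∃ ψ : A ⟶ θ.C (SSet.stdSimplex.obj n.unop) R,
      ψ ≫ θ.cmap (𝟙 _) φ = u.1 ≫ θ.res (lift (𝟙 _) (SSet.const k₀)) := by
  refine DGOperad.Alg.exists_factorization _ (cmap_injective hφ _) _ fun q a => ?_
  have h (m) (x : (SSet.stdSimplex.obj n.unop : SSet.{0}) _⦋m.1⦌) :
      (θ.cochain (u.1 ≫ θ.res (lift (𝟙 _) (SSet.const k₀))) q a).1 m x ∈ φ.range := by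
    have := u.2 q a m ((lift (𝟙 _) (SSet.const k₀) :
      SSet.stdSimplex.obj n.unop ⟶ SSet.stdSimplex.obj n.unop ⊗ K).app _ x)
    rw [← hk₀ (K.map (SimplexCategory.const _ _ 0).op k₀)]
    exact this
  choose f hf using h
  exact ⟨⟨f, fun m x hx => hφ (((hf m x).trans
    ((θ.cochain _ q a).2 m x hx)).trans (map_zero φ).symm)⟩, ext_apply hf⟩

/-- The retraction of a mapping space to `T(A; R)` given by evaluation at a vertex. -/
def ofMapping {φ : R →+* S} (hφ : Function.Injective φ) (k₀ : K _⦋0⦌)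
    (hk₀ : ∀ {n : SimplexCategoryᵒᵖ} (k : K.obj n),
      ρ.val ((SSet.const k₀ : K ⟶ K).app n k) = φ.range) :
    θ.mapping A K ρ ⟶ (θ.T A).obj (CommRingCat.of R) where
  app n := ↾fun u => (exists_ofMapping hφ k₀ hk₀ u).choose
  naturality n m f := by
    ext u
    refine comp_cmap_injective hφ ?_
    refine (exists_ofMapping hφ k₀ hk₀ ((θ.mapping A K ρ).map f u)).choose_spec.trans ?_
    exact (congrArg (· ≫ θ.res (SSet.stdSimplex.map f.unop))
      (exists_ofMapping hφ k₀ hk₀ u).choose_spec).symm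

/-- The homotopy on a mapping space given by a homotopy on its source. -/
def mappingHomotopy (H : K ⊗ Δ[1] ⟶ K)
    (hH : ∀ {n : SimplexCategoryᵒᵖ} (y : (K ⊗ Δ[1] : SSet.{0}).obj n),
      ρ.val (H.app n y) ≤ ρ.val y.1) :
    θ.mapping A K ρ ⊗ Δ[1] ⟶ θ.mapping A K ρ where
  app n := ↾fun w => ⟨w.1.1 ≫ θ.res (lift (fst _ _) (lift (snd _ _) (fst _ _ ≫
    (SSet.yonedaEquiv.symm w.2 : SSet.stdSimplex.obj n.unop ⟶ Δ[1])) ≫ H)),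
    w.1.2.res _ fun y => hH _⟩
  naturality n m f := by
    ext w
    refine mapping_ext fun q a l y => congrArg ((θ.cochain w.1.1 q a).1 l) (Prod.ext rfl ?_)
    refine congrArg (H.app _) (Prod.ext rfl ?_)
    exact ConcreteCategory.congr_hom (NatTrans.congr_app
      (SSet.yonedaEquiv_symm_naturality_left f.unop w.2).symm _) y.1

/-- The morphism from `T(A; R)` to a mapping space is a weak equivalence if the source of the
mapping space can be contracted to a vertex. -/
lemma isWeakEquivalence_toMapping {φ : R →+* S} (hφ : Function.Injective φ) (k₀ : K _⦋0⦌)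
    (hk₀ : ∀ {n : SimplexCategoryᵒᵖ} (k : K.obj n),
      ρ.val ((SSet.const k₀ : K ⟶ K).app n k) = φ.range)
    (H : K ⊗ Δ[1] ⟶ K) (hH : ∀ {n : SimplexCategoryᵒᵖ} (y : (K ⊗ Δ[1] : SSet.{0}).obj n),
      ρ.val (H.app n y) ≤ ρ.val y.1) (hH₀ : SSet.ι₀ ≫ H = SSet.const k₀) (hH₁ : SSet.ι₁ ≫ H = 𝟙 K)
    (h : ∀ {n : SimplexCategoryᵒᵖ} (k : K.obj n), φ.range ≤ ρ.val k) :
    IsWeakEquivalence (toMapping (θ := θ) (A := A) φ h) := by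
  have e : toMapping (θ := θ) (A := A) φ h ≫ ofMapping hφ k₀ hk₀ = 𝟙 _ := by
    ext n ψ
    refine comp_cmap_injective hφ ?_
    exact (exists_ofMapping hφ k₀ hk₀ ((toMapping (θ := θ) (A := A) φ h).app n ψ)).choose_spec
  refine isWeakEquivalence_of_homotopy (g := ofMapping hφ k₀ hk₀) (e ▸ .refl' _)
    (.mk' (mappingHomotopy H hH) ?_ ?_)
  · ext n u
    refine mapping_ext fun q a l y => ?_
    have h₁ := congrArg (fun w => (θ.cochain w q a).1 l y.1)
      (exists_ofMapping hφ k₀ hk₀ u).choose_spec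
    refine Eq.trans ?_ h₁.symm
    refine congrArg ((θ.cochain u.1 q a).1 l) (Prod.ext rfl ?_)
    exact ConcreteCategory.congr_hom (NatTrans.congr_app hH₀ _) y.2
  · ext n u
    refine mapping_ext fun q a l y => ?_
    refine congrArg ((θ.cochain u.1 q a).1 l) (Prod.ext rfl ?_)
    exact ConcreteCategory.congr_hom (NatTrans.congr_app hH₁ _) y.2

end CochainAction

/-! ### Fibrations between mapping spaces -/

section

open MonoidalCategory CartesianMonoidalCategory

variable {S : Type} [CommRing S]

namespace RingCoeff

/-- The constant system of coefficient rings. -/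
def const (K : SSet.{0}) (R : Subring S) : RingCoeff K S where
  val _ := R
  val_map_le _ _ := le_rfl

open Classical in
/-- The system of coefficient rings on `Δ[1]` which is `R` at the vertex `0` and `S` elsewhere. -/
def interval (R : Subring S) : RingCoeff Δ[1] S where
  val {n} s := if s ∈ (endpoint 0).obj n then R else ⊤
  val_map_le {n m} f s := by
    by_cases hs : s ∈ (endpoint 0).obj n
    · rw [if_pos hs, if_pos (show (Δ[1] : SSet.{0}).map f s ∈ (endpoint 0).obj m from
        (endpoint 0).map f hs)]
    · rw [if_neg hs]
      exact le_top

lemma interval_of_mem (R : Subring S) {n : SimplexCategoryᵒᵖ} {s : (Δ[1] : SSet.{0}).obj n}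
    (hs : s ∈ (endpoint 0).obj n) : (interval R).val s = R := if_pos hs

lemma interval_of_notMem (R : Subring S) {n : SimplexCategoryᵒᵖ} {s : (Δ[1] : SSet.{0}).obj n}
    (hs : s ∉ (endpoint 0).obj n) : (interval R).val s = ⊤ := if_neg hs

/-- The system of coefficient rings on `Δ[1] ⊗ Δ[1]` which is the intersection of the systems on
the two factors. -/
def square (P Q : Subring S) : RingCoeff (Δ[1] ⊗ Δ[1]) S where
  val y := (interval P).val y.1 ⊓ (interval Q).val y.2
  val_map_le f y := inf_le_inf ((interval P).val_map_le f y.1) ((interval Q).val_map_le f y.2)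

end RingCoeff

/-- The inclusion of a vertex of `Δ[1]`. -/
abbrev vertex (X : SSet.{0}) (k : Fin 2) : X ⟶ Δ[1] := SSet.const (SSet.stdSimplex.obj₀Equiv.symm k)

lemma vertex_mem {X : SSet.{0}} (k : Fin 2) {n : SimplexCategoryᵒᵖ} (x : X.obj n) :
    (vertex X k).app n x ∈ (endpoint k).obj n := by
  induction n using Opposite.rec with | _ n
  induction n using SimplexCategory.rec with | _ n
  exact (SSet.stdSimplex.mem_face_iff _ _).2 fun i => Finset.mem_singleton.2 rfl

lemma endpoint_disjoint {n : SimplexCategoryᵒᵖ} {s : (Δ[1] : SSet.{0}).obj n}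
    (h₀ : s ∈ (endpoint 0).obj n) : s ∉ (endpoint 1).obj n :=
  cylinderEnd_disjoint (X := Δ[1]) (y := (s, s)) h₀

lemma RingCoeff.interval_vertex_zero (R : Subring S) {X : SSet.{0}} {n : SimplexCategoryᵒᵖ}
    (x : X.obj n) : (interval R).val ((vertex X 0).app n x) = R :=
  interval_of_mem R (vertex_mem 0 x)

lemma RingCoeff.interval_vertex_one (R : Subring S) {X : SSet.{0}} {n : SimplexCategoryᵒᵖ}
    (x : X.obj n) : (interval R).val ((vertex X 1).app n x) = ⊤ :=
  interval_of_notMem R fun h => endpoint_disjoint h (vertex_mem 1 x)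

lemma eq_of_point {n : SimplexCategoryᵒᵖ} (l l' : (Δ[0] : SSet.{0}).obj n) : l = l' :=
  SSet.yonedaEquiv.symm.injective (SSet.stdSimplex.isTerminalObj₀.hom_ext _ _)

lemma exists_vertex_iff {n : SimplexCategoryᵒᵖ} (k : Fin 2) (s : (Δ[1] : SSet.{0}).obj n) :
    (∃ l, (vertex Δ[0] k).app n l = s) ↔ s ∈ (endpoint k).obj n := by
  constructor
  · rintro ⟨l, rfl⟩
    exact vertex_mem k l
  · intro h
    exact ⟨(SSet.stdSimplex.isTerminalObj₀.from Δ[1]).app n s,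
      eq_of_mem_endpoint (vertex_mem k _) h⟩

end

namespace Coeff

open MonoidalCategory CartesianMonoidalCategory

variable {X : SSet.{0}} {S : Type} [CommRing S]

/-- The projection from the product with a point. -/
def prodPointIso (X : SSet.{0}) : X ⊗ Δ[0] ≅ X where
  hom := fst X Δ[0]
  inv := lift (𝟙 X) (SSet.stdSimplex.isTerminalObj₀.from X)
  hom_inv_id := CartesianMonoidalCategory.hom_ext _ _ rfl
    (SSet.stdSimplex.isTerminalObj₀.hom_ext _ _)
  inv_hom_id := rfl

lemma rel_of_mem {Y : SSet.{0}} {B : Y.Subcomplex} (τ : Coeff Y S) {n : SimplexCategoryᵒᵖ}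
    {y : Y.obj n} (hy : y ∈ B.obj n) : (rel B τ).val y = ⊥ := ite_of_mem _ hy

lemma rel_of_notMem {Y : SSet.{0}} {B : Y.Subcomplex} (τ : Coeff Y S) {n : SimplexCategoryᵒᵖ}
    {y : Y.obj n} (hy : y ∉ B.obj n) : (rel B τ).val y = τ.val y := ite_of_notMem _ hy

lemma path_of_mem {σ₀ σ₁ : Coeff X S} (h : σ₀ ≤ σ₁) {n : SimplexCategoryᵒᵖ}
    {y : (X ⊗ Δ[1] : SSet.{0}).obj n} (hy : y ∈ (cylinderEnd X 0).obj n) :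
    (path σ₀ σ₁ h).val y = σ₀.val y.1 := ite_of_mem (comap_mono _ h) hy

lemma path_of_notMem {σ₀ σ₁ : Coeff X S} (h : σ₀ ≤ σ₁) {n : SimplexCategoryᵒᵖ}
    {y : (X ⊗ Δ[1] : SSet.{0}).obj n} (hy : y ∉ (cylinderEnd X 0).obj n) :
    (path σ₀ σ₁ h).val y = σ₁.val y.1 := ite_of_notMem (comap_mono _ h) hy

lemma acyclic_of_val_eq {Y : SSet.{0}} {τ τ' : Coeff Y S} (hτ : τ'.Acyclic)
    (h : ∀ {n : SimplexCategoryᵒᵖ} (y : Y.obj n), τ.val y = τ'.val y) : τ.Acyclic := by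
  have : τ = τ' := Coeff.ext (funext fun n => funext fun y => h y)
  rwa [this]

end Coeff

namespace CochainAction

open normCochains MonoidalCategory CartesianMonoidalCategory

variable {E : DGOperad} {θ : CochainAction E} {A : E.Alg} {S : Type} [CommRing S]

-- A horn filling is an extension problem for the cochains relative to the horn. Over a point there
-- is no further boundary condition, hence the empty index set.
open Coeff in
lemma kanComplex_mapping (hA : A.IsCofibrant) (R : Subring S) :
    SSet.KanComplex (θ.mapping A Δ[0] (.const Δ[0] R)) := by
  refine (isFibrant_iff _).2 ⟨?_⟩
  rw [fibrations_eq]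
  intro _ _ _ hf
  simp only [J, MorphismProperty.iSup_iff] at hf
  obtain ⟨n, ⟨i⟩⟩ := hf
  refine ⟨fun {t _} sq => ?_⟩
  have hB {m : SimplexCategoryᵒᵖ} (y : (Δ[n + 1] ⊗ Δ[0] : SSet.{0}).obj m) :
      y ∈ (Λ[n + 1, i].preimage (fst _ Δ[0])).obj m ↔ (∃ x', Λ[n + 1, i].ι.app m x' = y.1) ∨
        ∃ (j : Empty) (l : (Δ[0] : SSet.{0}).obj m), j.elim = y.2 := by
    constructor
    · intro hy
      exact .inl ⟨⟨_, hy⟩, rfl⟩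
    · rintro (⟨x', hx'⟩ | ⟨j, -⟩)
      · exact (congrArg (· ∈ (Λ[n + 1, i]).obj _) hx').mp x'.2
      · exact j.elim
  have hac : (rel (Λ[n + 1, i].preimage (fst _ Δ[0]))
      (RingCoeff.comap (snd _ _) (.const Δ[0] R)).toCoeff).Acyclic :=
    .comap_iso (prodPointIso _).symm (acyclic_of_val_eq (acyclic_horn i R.toAddSubgroup) fun y => by
      by_cases hy : y ∈ (Λ[n + 1, i]).obj _
      · exact (rel_of_mem (B := Λ[n + 1, i].preimage (fst _ Δ[0]))
          (y := (prodPointIso _).inv.app _ y) _ hy).trans (rel_of_mem _ hy).symm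
      · exact (rel_of_notMem (B := Λ[n + 1, i].preimage (fst _ Δ[0]))
          (y := (prodPointIso _).inv.app _ y) _ hy).trans
          (rel_of_notMem (const _ R.toAddSubgroup) hy).symm)
  obtain ⟨u, hu, -⟩ := exists_lift (J := Empty) (L := fun _ => Δ[0]) hA Λ[n + 1, i].ι t
    (fun j => j.elim) (fun j => j.elim) (fun j => j.elim) (fun j => j.elim) (fun j => j.elim)
    (fun j => j.elim) (fun j => j.elim) _ (fun y => (hB y).trans (or_congr .rfl
      (exists_congr fun j => j.elim))) hac
  exact ⟨⟨⟨u, hu, terminal.hom_ext _ _⟩⟩⟩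

/-- Evaluation at the end `1` of paths with coefficients `R` at the end `0`. -/
def evalOne (R : Subring S) : θ.mapping A Δ[1] (.interval R) ⟶ θ.mapping A Δ[0] (.const Δ[0] (⊤ : Subring S)) :=
  mappingMap (vertex Δ[0] 1) fun _ => le_top

-- The subcomplex consists of the horn times the interval and the end `1`. The relative complex is a
-- path complex for the cochains relative to the horn over `R` and over `S`; both are acyclic, hence
-- so is their quotient, and `acyclic_path` applies.
open Coeff in
lemma fibration_evalOne (hA : A.IsCofibrant) (R : Subring S) :
    Fibration (evalOne R : θ.mapping A Δ[1] _ ⟶ _) := by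
  rw [SSet.modelCategoryQuillen.fibration_iff]
  intro _ _ _ hf
  simp only [J, MorphismProperty.iSup_iff] at hf
  obtain ⟨n, ⟨i⟩⟩ := hf
  refine ⟨fun {t v} sq => ?_⟩
  have hle : rel Λ[n + 1, i] (const Δ[n + 1] R.toAddSubgroup) ≤
      rel Λ[n + 1, i] (const Δ[n + 1] (⊤ : AddSubgroup S)) := rel_mono _ fun _ => le_top
  let B : (Δ[n + 1] ⊗ Δ[1] : SSet.{0}).Subcomplex :=
    Λ[n + 1, i].preimage (fst _ Δ[1]) ⊔ cylinderEnd _ 1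
  have hB {m : SimplexCategoryᵒᵖ} (y : (Δ[n + 1] ⊗ Δ[1] : SSet.{0}).obj m) :
      y ∈ B.obj m ↔ (∃ x', Λ[n + 1, i].ι.app m x' = y.1) ∨
        ∃ (_ : Unit) (l : (Δ[0] : SSet.{0}).obj m), (vertex Δ[0] 1).app m l = y.2 := by
    constructor
    · rintro (hy | hy)
      · exact .inl ⟨⟨_, hy⟩, rfl⟩
      · exact .inr ⟨(), (exists_vertex_iff 1 y.2).2 hy⟩
    · rintro (⟨x', hx'⟩ | ⟨j, hj⟩)
      · exact .inl ((congrArg (· ∈ (Λ[n + 1, i]).obj _) hx').mp x'.2)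
      · exact .inr ((exists_vertex_iff 1 y.2).1 hj)
  have hac : (rel B (RingCoeff.comap (snd _ _) (.interval R)).toCoeff).Acyclic := by
    refine acyclic_of_val_eq (acyclic_path hle
      ((acyclic_horn i _).quotient (acyclic_horn i _) hle)) fun {m} y => ?_
    by_cases h₁ : y ∈ (cylinderEnd _ 1).obj m
    · rw [rel_of_mem _ h₁, rel_of_mem _ (show y ∈ B.obj m from .inr h₁)]
    rw [rel_of_notMem _ h₁]
    by_cases hy : y.1 ∈ (Λ[n + 1, i]).obj m
    · rw [rel_of_mem _ (show y ∈ B.obj m from .inl hy)]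
      by_cases h₀ : y ∈ (cylinderEnd _ 0).obj m
      · rw [path_of_mem hle h₀]
        exact (rel_of_mem (const _ R.toAddSubgroup) hy).symm
      · rw [path_of_notMem hle h₀]
        exact (rel_of_mem (const _ ⊤) hy).symm
    · rw [rel_of_notMem _ (show y ∉ B.obj m from fun h => h.elim hy h₁)]
      by_cases h₀ : y ∈ (cylinderEnd _ 0).obj m
      · rw [path_of_mem hle h₀]
        exact (congrArg Subring.toAddSubgroup (RingCoeff.interval_of_mem R h₀)).trans
          (rel_of_notMem (const _ R.toAddSubgroup) hy).symm
      · rw [path_of_notMem hle h₀]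
        exact (congrArg Subring.toAddSubgroup (RingCoeff.interval_of_notMem R h₀)).trans
          (rel_of_notMem (const _ ⊤) hy).symm
  obtain ⟨u, hu, hu'⟩ := exists_lift (J := Unit) (L := fun _ => Δ[0]) hA Λ[n + 1, i].ι t
    (fun _ => vertex Δ[0] 1) (fun _ => .const Δ[0] (⊤ : Subring S)) (fun _ => fun _ => le_top)
    (fun _ => fun l => (RingCoeff.interval_vertex_one R l).ge) (fun _ => v)
    (fun _ => sq.w.symm) (fun _ _ _ l l' _ => ⟨Δ[0], 𝟙 _, 𝟙 _, l, .const Δ[0] (⊤ : Subring S),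
      fun _ => le_rfl, fun _ => le_rfl, rfl, eq_of_point l l', rfl⟩) B hB hac
  exact ⟨⟨⟨u, hu, hu' ()⟩⟩⟩

end CochainAction

/-! ### The mapping space of the square and the pullback -/

namespace Coeff

open MonoidalCategory CartesianMonoidalCategory

variable {X : SSet.{0}} {S : Type} [CommRing S]

/-- The cochains on `X ⊗ Δ[1] ⊗ Δ[1]` with coefficients `P` where the first coordinate is `0` and
`Q` where the second one is `0`, relative to a subcomplex of `X` and to the simplices where one of
the coordinates is `1`, form an acyclic complex. -/
lemma acyclic_square {P Q : Subring S} (hPQ : P.toAddSubgroup ⊔ Q.toAddSubgroup = ⊤)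
    (B₀ : X.Subcomplex) :
    (rel (B₀.preimage (fst X (Δ[1] ⊗ Δ[1])) ⊔ (endpoint 1).preimage (snd X _ ≫ fst Δ[1] Δ[1]) ⊔
        (endpoint 1).preimage (snd X _ ≫ snd Δ[1] Δ[1]))
      (RingCoeff.comap (snd X _) (.square P Q)).toCoeff).Acyclic := by
  let a := rel B₀ (const X P.toAddSubgroup)
  let b := rel B₀ (const X Q.toAddSubgroup)
  let c := rel B₀ (const X (⊤ : AddSubgroup S))
  have hac : a ≤ c := rel_mono _ fun _ => le_top
  have hbc : b ≤ c := rel_mono _ fun _ => le_top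
  have hc {n : SimplexCategoryᵒᵖ} (x : X.obj n) : c.val x ≤ a.val x ⊔ b.val x := by
    by_cases hx : x ∈ B₀.obj n
    · rw [rel_of_mem _ hx]
      exact _root_.bot_le
    · rw [rel_of_notMem _ hx, rel_of_notMem _ hx, rel_of_notMem _ hx]
      exact hPQ.ge
  have hle : rel (cylinderEnd X 1) (path (a ⊓ b) b (a.inf_le_right b)) ≤
      rel (cylinderEnd X 1) (path a c hac) := rel_mono _ fun {n} y => by
    by_cases hy : y ∈ (cylinderEnd X 0).obj n
    · rw [path_of_mem _ hy, path_of_mem _ hy]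
      exact inf_le_left
    · rw [path_of_notMem _ hy, path_of_notMem _ hy]
      exact hbc y.1
  set B := B₀.preimage (fst X (Δ[1] ⊗ Δ[1])) ⊔ (endpoint 1).preimage (snd X _ ≫ fst Δ[1] Δ[1]) ⊔
    (endpoint 1).preimage (snd X _ ≫ snd Δ[1] Δ[1])
  set τ := (RingCoeff.comap (snd X _) (.square P Q)).toCoeff
  -- Rebracketed as a cylinder over the cylinder `X ⊗ Δ[1]`, the coefficients form an iterated path
  -- system: the inner coordinate accounts for `P`, the outer one for `Q`. The rest compares the
  -- values according to the position of each coordinate.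
  refine .comap_iso (α_ X Δ[1] Δ[1]) (acyclic_of_val_eq
    (acyclic_path hle (acyclicQuotient_path hac hbc hc)) fun {n} y => ?_)
  let z : (X ⊗ Δ[1] ⊗ Δ[1] : SSet.{0}).obj n := (y.1.1, (y.1.2, y.2))
  change (rel B τ).val z = _
  have hτ : τ.val z =
    ((RingCoeff.interval P).val y.1.2 ⊓ (RingCoeff.interval Q).val y.2).toAddSubgroup := rfl
  by_cases hs : y ∈ (cylinderEnd (X ⊗ Δ[1]) 1).obj n
  · rw [rel_of_mem _ hs, rel_of_mem τ (show z ∈ B.obj n from .inr hs)]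
  rw [rel_of_notMem _ hs]
  by_cases ht : y.1 ∈ (cylinderEnd X 1).obj n
  · rw [rel_of_mem τ (show z ∈ B.obj n from .inl (.inr ht))]
    by_cases hs₀ : y ∈ (cylinderEnd (X ⊗ Δ[1]) 0).obj n
    · rw [path_of_mem hle hs₀, rel_of_mem _ ht]
    · rw [path_of_notMem hle hs₀, rel_of_mem _ ht]
  by_cases hx : y.1.1 ∈ B₀.obj n
  · rw [rel_of_mem τ (show z ∈ B.obj n from .inl (.inl hx))]
    have ha : a.val y.1.1 = ⊥ := rel_of_mem _ hx
    have hb : b.val y.1.1 = ⊥ := rel_of_mem _ hx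
    have hc : c.val y.1.1 = ⊥ := rel_of_mem _ hx
    have hab : (a ⊓ b).val y.1.1 = ⊥ := (congrArg₂ (· ⊓ ·) ha hb).trans (bot_inf_eq _)
    by_cases hs₀ : y ∈ (cylinderEnd (X ⊗ Δ[1]) 0).obj n <;>
    by_cases ht₀ : y.1 ∈ (cylinderEnd X 0).obj n
    · rw [path_of_mem hle hs₀, rel_of_notMem _ ht, path_of_mem _ ht₀, hab]
    · rw [path_of_mem hle hs₀, rel_of_notMem _ ht, path_of_notMem _ ht₀, hb]
    · rw [path_of_notMem hle hs₀, rel_of_notMem _ ht, path_of_mem _ ht₀, ha]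
    · rw [path_of_notMem hle hs₀, rel_of_notMem _ ht, path_of_notMem _ ht₀, hc]
  rw [rel_of_notMem τ (show z ∉ B.obj n from fun h => h.elim (fun h => h.elim hx ht) hs), hτ]
  have ha : a.val y.1.1 = P.toAddSubgroup := rel_of_notMem _ hx
  have hb : b.val y.1.1 = Q.toAddSubgroup := rel_of_notMem _ hx
  have hc : c.val y.1.1 = ⊤ := rel_of_notMem _ hx
  have hab : (a ⊓ b).val y.1.1 = P.toAddSubgroup ⊓ Q.toAddSubgroup := congrArg₂ (· ⊓ ·) ha hb
  by_cases hs₀ : y ∈ (cylinderEnd (X ⊗ Δ[1]) 0).obj n <;>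
  by_cases ht₀ : y.1 ∈ (cylinderEnd X 0).obj n
  · rw [path_of_mem hle hs₀, rel_of_notMem _ ht, path_of_mem _ ht₀, hab]
    exact congrArg Subring.toAddSubgroup ((congrArg₂ (· ⊓ ·) (RingCoeff.interval_of_mem P ht₀)
      (RingCoeff.interval_of_mem Q hs₀)).trans rfl)
  · rw [path_of_mem hle hs₀, rel_of_notMem _ ht, path_of_notMem _ ht₀, hb]
    exact congrArg Subring.toAddSubgroup ((congrArg₂ (· ⊓ ·) (RingCoeff.interval_of_notMem P ht₀)
      (RingCoeff.interval_of_mem Q hs₀)).trans (top_inf_eq _))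
  · rw [path_of_notMem hle hs₀, rel_of_notMem _ ht, path_of_mem _ ht₀, ha]
    exact congrArg Subring.toAddSubgroup ((congrArg₂ (· ⊓ ·) (RingCoeff.interval_of_mem P ht₀)
      (RingCoeff.interval_of_notMem Q hs₀)).trans (inf_top_eq _))
  · rw [path_of_notMem hle hs₀, rel_of_notMem _ ht, path_of_notMem _ ht₀, hc]
    exact congrArg Subring.toAddSubgroup ((congrArg₂ (· ⊓ ·) (RingCoeff.interval_of_notMem P ht₀)
      (RingCoeff.interval_of_notMem Q hs₀)).trans (inf_top_eq _))

end Coeff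

/-! ### Restriction from the square to the two edges -/

namespace CochainAction

open normCochains MonoidalCategory CartesianMonoidalCategory

variable {E : DGOperad} {θ : CochainAction E} {A : E.Alg} {S : Type} [CommRing S] (P Q : Subring S)

/-- Restriction to the simplices whose second coordinate is `1`. -/
def squareFst : θ.mapping A (Δ[1] ⊗ Δ[1]) (.square P Q) ⟶ θ.mapping A Δ[1] (.interval P) :=
  mappingMap (lift (𝟙 _) (vertex Δ[1] 1)) fun _ => inf_le_left

/-- Restriction to the simplices whose first coordinate is `1`. -/
def squareSnd : θ.mapping A (Δ[1] ⊗ Δ[1]) (.square P Q) ⟶ θ.mapping A Δ[1] (.interval Q) :=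
  mappingMap (lift (vertex Δ[1] 1) (𝟙 _)) fun _ => inf_le_right

/-- Both composites are evaluation at the vertex `(1, 1)`. -/
lemma squareFst_evalOne :
    (squareFst P Q : θ.mapping A _ _ ⟶ _) ≫ evalOne P = squareSnd P Q ≫ evalOne Q := by
  ext n u
  refine mapping_ext fun q a m y =>
    congrArg ((θ.cochain u.1 q a).1 m) (Prod.ext rfl (Prod.ext ?_ ?_))
  · exact eq_of_mem_endpoint (vertex_mem 1 y.2) (vertex_mem 1 ((vertex Δ[0] 1).app _ y.2))
  · exact eq_of_mem_endpoint (vertex_mem 1 ((vertex Δ[0] 1).app _ y.2)) (vertex_mem 1 y.2)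

/-- The comparison with the pullback. -/
def squareToPullback : θ.mapping A (Δ[1] ⊗ Δ[1]) (.square P Q) ⟶
    pullback (evalOne P : θ.mapping A _ _ ⟶ _) (evalOne Q) :=
  pullback.lift (squareFst P Q) (squareSnd P Q) (squareFst_evalOne P Q)

variable {P Q}

/-- A map to the pullback is a pair of families on the two edges that agree at `(1, 1)`. Extending
such a pair to the square, with prescribed values over `X'`, is possible by `acyclic_square`. -/
lemma hasLiftingProperty_squareToPullback (hA : A.IsCofibrant)
    (hPQ : P.toAddSubgroup ⊔ Q.toAddSubgroup = ⊤) {X' X : SSet.{0}} (i : X' ⟶ X) [Mono i] :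
    HasLiftingProperty i (squareToPullback (θ := θ) (A := A) P Q) := by
  refine ⟨fun {t v} sq => ?_⟩
  have h₁ : i ≫ v ≫ pullback.fst _ _ = t ≫ squareFst P Q := by
    rw [← Category.assoc, ← sq.w, Category.assoc]
    exact congrArg (t ≫ ·) (pullback.lift_fst _ _ _)
  have h₂ : i ≫ v ≫ pullback.snd _ _ = t ≫ squareSnd P Q := by
    rw [← Category.assoc, ← sq.w, Category.assoc]
    exact congrArg (t ≫ ·) (pullback.lift_snd _ _ _)
  have h₁₂ : (v ≫ pullback.fst _ _) ≫ evalOne P = (v ≫ pullback.snd _ _) ≫ evalOne Q := by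
    rw [Category.assoc, Category.assoc, pullback.condition]
  have hB {n : SimplexCategoryᵒᵖ} (y : (X ⊗ Δ[1] ⊗ Δ[1] : SSet.{0}).obj n) :
      y ∈ ((SSet.Subcomplex.range i).preimage (fst X (Δ[1] ⊗ Δ[1])) ⊔
        (endpoint 1).preimage (snd X _ ≫ fst Δ[1] Δ[1]) ⊔
        (endpoint 1).preimage (snd X _ ≫ snd Δ[1] Δ[1])).obj n ↔ (∃ x', i.app n x' = y.1) ∨
      ∃ (j : Bool) (l : (Δ[1] : SSet.{0}).obj n),
        ((match j with
          | true => lift (𝟙 _) (vertex Δ[1] 1)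
          | false => lift (vertex Δ[1] 1) (𝟙 _) :
        (Δ[1] : SSet.{0}) ⟶ Δ[1] ⊗ Δ[1])).app n l = y.2 := by
    constructor
    · rintro ((h | h) | h)
      · exact .inl h
      · exact .inr ⟨false, y.2.2, Prod.ext (eq_of_mem_endpoint (vertex_mem 1 y.2.2) h) rfl⟩
      · exact .inr ⟨true, y.2.1, Prod.ext rfl (eq_of_mem_endpoint (vertex_mem 1 y.2.1) h)⟩
    · rintro (h | ⟨_ | _, l, h⟩)
      · exact .inl (.inl h)
      · refine .inl (.inr ?_)
        exact (congrArg (· ∈ (endpoint 1).obj n) (congrArg Prod.fst h)).mp (vertex_mem 1 l)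
      · refine .inr ?_
        exact (congrArg (· ∈ (endpoint 1).obj n) (congrArg Prod.snd h)).mp (vertex_mem 1 l)
  obtain ⟨u, hu, hu'⟩ := exists_lift (J := Bool) (L := fun _ => Δ[1]) hA i t
    (fun j => match j with
      | true => lift (𝟙 _) (vertex Δ[1] 1)
      | false => lift (vertex Δ[1] 1) (𝟙 _))
    (fun j => match j with
      | true => .interval P
      | false => .interval Q)
    (fun j => match j with
      | true => fun _ => inf_le_left
      | false => fun _ => inf_le_right)
    (fun j => match j with
      | true => fun l => le_inf le_rfl (le_top.trans (RingCoeff.interval_vertex_one Q l).ge)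
      | false => fun l => le_inf (le_top.trans (RingCoeff.interval_vertex_one P l).ge) le_rfl)
    (fun j => match j with
      | true => v ≫ pullback.fst _ _
      | false => v ≫ pullback.snd _ _)
    (fun j => match j with
      | true => h₁
      | false => h₂)
    -- Each edge is embedded in the square, so only the two mixed cases carry a condition. There the
    -- overlap is the vertex `(1, 1)`, and agreement is the pullback condition.
    (fun j j' => match j, j' with
      | true, true => fun l l' h => ⟨Δ[1], 𝟙 _, 𝟙 _, l, .interval P, fun _ => le_rfl,
          fun _ => le_rfl, rfl, congrArg Prod.fst h, rfl⟩
      | true, false => fun l l' h => ⟨Δ[0], vertex Δ[0] 1, vertex Δ[0] 1,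
          (SSet.stdSimplex.isTerminalObj₀.from Δ[1]).app _ l, .const Δ[0] ⊤, fun _ => le_top,
          fun _ => le_top, (congrArg Prod.fst h).symm, congrArg Prod.snd h, h₁₂⟩
      | false, true => fun l l' h => ⟨Δ[0], vertex Δ[0] 1, vertex Δ[0] 1,
          (SSet.stdSimplex.isTerminalObj₀.from Δ[1]).app _ l, .const Δ[0] ⊤, fun _ => le_top,
          fun _ => le_top, (congrArg Prod.snd h).symm, congrArg Prod.fst h, h₁₂.symm⟩
      | false, false => fun l l' h => ⟨Δ[1], 𝟙 _, 𝟙 _, l, .interval Q, fun _ => le_rfl,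
          fun _ => le_rfl, rfl, congrArg Prod.snd h, rfl⟩)
    _ hB (Coeff.acyclic_square hPQ _)
  refine ⟨⟨⟨u, hu, pullback.hom_ext ?_ ?_⟩⟩⟩
  · rw [Category.assoc]
    exact (congrArg (u ≫ ·) (pullback.lift_fst _ _ _)).trans (hu' true)
  · rw [Category.assoc]
    exact (congrArg (u ≫ ·) (pullback.lift_snd _ _ _)).trans (hu' false)

end CochainAction

/-! ### The arithmetic square of rings -/

section

open scoped TensorProduct

lemma PadicInt.isUnit_natCast_of_ne {p ℓ : ℕ} [Fact p.Prime] (hℓ : ℓ.Prime) (h : p ≠ ℓ) :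
    IsUnit (ℓ : ℤ_[p]) := by
  rw [PadicInt.isUnit_iff]
  by_contra h'
  have h₁ := lt_of_le_of_ne (PadicInt.norm_le_one (ℓ : ℤ_[p])) h'
  have h₂ := (PadicInt.norm_int_lt_one_iff_dvd (p := p) (ℓ : ℤ)).1 (by simpa using h₁)
  exact h ((Nat.prime_dvd_prime_iff_eq Fact.out hℓ).1 (Int.natCast_dvd_natCast.1 h₂))

/-- The integers are dense in their finite completion. -/
lemma ZHat.exists_eq_intCast_add (b : ℕ) (hb : b ≠ 0) :
    ∀ z : ZHat, ∃ (m : ℤ) (w : ZHat), z = m + b * w := by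
  induction b using induction_on_primes with
  | zero => exact (hb rfl).elim
  | one => exact fun z => ⟨0, z, by simp⟩
  | prime_mul ℓ b hℓ ih =>
    intro z
    obtain ⟨m, w, rfl⟩ := ih (by rintro rfl; simp at hb) z
    -- Only the component at `ℓ` restricts the choice of `m'`: it must have the right residue there.
    -- In the other components `ℓ` is a unit.
    have : ∃ (m' : ℤ) (w' : ZHat), w = m' + ℓ * w' := by
      have : Fact ℓ.Prime := ⟨hℓ⟩
      let x₀ : ℤ_[ℓ] := w ⟨ℓ, hℓ⟩
      let m' : ℕ := PadicInt.zmodRepr x₀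
      have h (p : Nat.Primes) : ∃ x : ℤ_[p], w p = m' + ℓ * x := by
        by_cases hp : p = ⟨ℓ, hℓ⟩
        · subst hp
          obtain ⟨x, hx⟩ := Ideal.mem_span_singleton.1
            ((PadicInt.maximalIdeal_eq_span_p (p := ℓ)) ▸ PadicInt.sub_zmodRepr_mem x₀)
          exact ⟨x, sub_eq_iff_eq_add'.1 hx⟩
        · obtain ⟨u, hu⟩ := PadicInt.isUnit_natCast_of_ne (p := p) hℓ
            fun h => hp (Subtype.ext h)
          exact ⟨(↑u⁻¹ : ℤ_[p]) * (w p - m'), by rw [← hu, Units.mul_inv_cancel_left]; ring⟩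
      choose w' hw' using h
      exact ⟨m', w', funext fun p => by simpa using hw' p⟩
    obtain ⟨m', w', rfl⟩ := this
    exact ⟨m + b * m', w', by push_cast; ring⟩

/-- Tensor the injection of ℤ in ℚ with the flat module `ZHat`. -/
lemma zHatToQHat_injective : Function.Injective zHatToQHat.hom := by
  have : Module.Flat ℤ ZHat := inferInstance
  exact Algebra.TensorProduct.includeLeft_injective (S := ℤ) (Int.cast_injective (α := ℚ))

lemma ZHat.intCast_injective : Function.Injective (Int.cast : ℤ → ZHat) := fun _ _ h =>
  Int.cast_injective (α := ℤ_[(⟨2, Nat.prime_two⟩ : Nat.Primes)])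
    (congrFun h ⟨2, Nat.prime_two⟩)

lemma ratToQHat_injective : Function.Injective ratToQHat.hom :=
  Algebra.TensorProduct.includeRight_injective (R := ℤ) (A := ZHat) (B := ℚ)
    ZHat.intCast_injective

lemma zHatToQHat_mul_ratToQHat (z : ZHat) (q : ℚ) :
    zHatToQHat.hom z * ratToQHat.hom q = (z ⊗ₜ[ℤ] q : QHat) :=
  (Algebra.TensorProduct.tmul_mul_tmul z 1 1 q).trans (by rw [mul_one, one_mul])

lemma range_zHatToQHat_sup_range_ratToQHat :
    zHatToQHat.hom.range.toAddSubgroup ⊔ ratToQHat.hom.range.toAddSubgroup = ⊤ := by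
  refine eq_top_iff.2 fun x _ => ?_
  change QHat at x
  induction x using TensorProduct.induction_on with
  | zero => exact zero_mem _
  | add x y hx hy => exact add_mem (hx trivial) (hy trivial)
  | tmul z q =>
    -- For q = a/b, density of ℤ modulo b gives a·z = m + b·w, hence z ⊗ q = w ⊗ 1 + 1 ⊗ m/b.
    obtain ⟨m, w, hw⟩ := ZHat.exists_eq_intCast_add q.den q.den_ne_zero (q.num * z)
    have hw' := congrArg zHatToQHat.hom hw
    simp only [map_mul, map_add, map_intCast, map_natCast] at hw'
    have hden : (q.den : QHat) * ratToQHat.hom (1 / q.den) = 1 := by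
      rw [← map_natCast ratToQHat.hom, ← map_mul, mul_one_div_cancel (by simp), map_one]
    have hq : ratToQHat.hom q = (q.num : QHat) * ratToQHat.hom (1 / q.den) := by
      rw [← map_intCast ratToQHat.hom, ← map_mul, mul_one_div, Rat.num_div_den]
    have key : (z ⊗ₜ[ℤ] q : QHat) = zHatToQHat.hom w + ratToQHat.hom (m * (1 / q.den)) := by
      rw [← zHatToQHat_mul_ratToQHat, hq, map_mul, map_intCast]
      linear_combination (ratToQHat.hom (1 / q.den)) * hw' + zHatToQHat.hom w * hden
    rw [key]
    exact AddSubgroup.add_mem_sup ⟨w, rfl⟩ ⟨_, rfl⟩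

lemma range_zHatToQHat_inf_range_ratToQHat :
    zHatToQHat.hom.range ⊓ ratToQHat.hom.range = (Int.castRingHom QHat).range := by
  refine le_antisymm ?_ (le_inf ?_ ?_)
  · rintro _ ⟨⟨z, rfl⟩, ⟨q, hq⟩⟩
    have h : (q.den : ZHat) * z = q.num := by
      apply zHatToQHat_injective
      rw [map_mul, map_natCast, map_intCast, ← hq, ← map_natCast ratToQHat.hom, ← map_mul,
        mul_comm, Rat.mul_den_eq_num, map_intCast]
    -- A prime `ℓ` dividing the denominator would divide the numerator in the `ℓ`-adic integers,
    -- hence in ℤ, although the fraction is reduced.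
    have hden : q.den = 1 := by
      by_contra hne
      obtain ⟨ℓ, hℓ, hdvd⟩ := Nat.exists_prime_and_dvd hne
      have : Fact ℓ.Prime := ⟨hℓ⟩
      let x : ℤ_[ℓ] := z ⟨ℓ, hℓ⟩
      have hx : (q.den : ℤ_[ℓ]) * x = q.num := congrFun h ⟨ℓ, hℓ⟩
      have h₁ : ‖((q.den : ℤ) : ℤ_[ℓ])‖ < 1 :=
        (PadicInt.norm_int_lt_one_iff_dvd _).2 (Int.natCast_dvd_natCast.2 hdvd)
      have h₂ : ‖(q.num : ℤ_[ℓ])‖ < 1 := by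
        rw [← hx, norm_mul]
        refine lt_of_le_of_lt (mul_le_of_le_one_right (norm_nonneg _) (PadicInt.norm_le_one x)) ?_
        simpa using h₁
      have h₃ := (PadicInt.norm_int_lt_one_iff_dvd _).1 h₂
      exact Nat.not_coprime_of_dvd_of_dvd hℓ.one_lt (Int.natCast_dvd.1 h₃) hdvd q.reduced
    refine ⟨q.num, ?_⟩
    rw [← hq, eq_intCast, ← map_intCast ratToQHat.hom, ← Rat.mul_den_eq_num q, hden]
    simp
  · rintro _ ⟨m, rfl⟩
    exact ⟨m, by simp⟩
  · rintro _ ⟨m, rfl⟩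
    exact ⟨m, by simp⟩

lemma intCast_qHat_injective : Function.Injective (Int.castRingHom QHat) := fun _ _ h =>
  ZHat.intCast_injective (zHatToQHat_injective (by simpa using h))

end

/-! ### Contractions -/

section

open MonoidalCategory CartesianMonoidalCategory

/-- The minimum, as a contraction of `Δ[1]` to the vertex `0`. -/
def minMap : (Δ[1] ⊗ Δ[1] : SSet.{0}) ⟶ Δ[1] :=
  squareMap ⟨fun a => a.1 ⊓ a.2, fun _ _ h => inf_le_inf h.1 h.2⟩

lemma minMap_zero {n : SimplexCategoryᵒᵖ} (s : (Δ[1] : SSet.{0}).obj n) {X : SSet.{0}}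
    (x : X.obj n) : minMap.app n (s, (vertex X 0).app n x) = (vertex X 0).app n x := by
  induction n using Opposite.rec with | _ n
  induction n using SimplexCategory.rec with | _ n
  exact SSet.stdSimplex.ext _ _ fun i => min_eq_right (Fin.zero_le _)

lemma minMap_one {n : SimplexCategoryᵒᵖ} (s : (Δ[1] : SSet.{0}).obj n) {X : SSet.{0}}
    (x : X.obj n) : minMap.app n (s, (vertex X 1).app n x) = s := by
  induction n using Opposite.rec with | _ n
  induction n using SimplexCategory.rec with | _ n
  exact SSet.stdSimplex.ext _ _ fun i => min_eq_left (Fin.le_last _)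

lemma minMap_mem {n : SimplexCategoryᵒᵖ} {s : (Δ[1] : SSet.{0}).obj n}
    (hs : s ∈ (endpoint 0).obj n) (r : (Δ[1] : SSet.{0}).obj n) :
    minMap.app n (s, r) ∈ (endpoint 0).obj n := by
  induction n using Opposite.rec with | _ n
  induction n using SimplexCategory.rec with | _ n
  refine (SSet.stdSimplex.mem_face_iff _ _).2 fun i => Finset.mem_singleton.2 ?_
  refine Fin.le_zero_iff.1 ((min_le_left _ _).trans (le_of_eq ?_))
  exact Finset.mem_singleton.1 ((SSet.stdSimplex.mem_face_iff _ _).1 hs i)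

/-- The minimum moves simplices towards the vertex `0`, where the coefficients are smallest, so the
contraction acts on mapping spaces. -/
lemma RingCoeff.interval_minMap_le {S : Type} [CommRing S] (R : Subring S)
    {n : SimplexCategoryᵒᵖ} (s r : (Δ[1] : SSet.{0}).obj n) :
    (interval R).val (minMap.app n (s, r)) ≤ (interval R).val s := by
  by_cases hs : s ∈ (endpoint 0).obj n
  · rw [interval_of_mem R hs, interval_of_mem R (minMap_mem hs r)]
  · rw [interval_of_notMem R hs]
    exact le_top

/-- The contraction of `Δ[1] ⊗ Δ[1]` to the vertex `(0, 0)`. -/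
def squareContraction : ((Δ[1] ⊗ Δ[1]) ⊗ Δ[1] : SSet.{0}) ⟶ Δ[1] ⊗ Δ[1] :=
  lift (lift (fst _ _ ≫ fst _ _) (snd _ _) ≫ minMap) (lift (fst _ _ ≫ snd _ _) (snd _ _) ≫ minMap)

end

/-! ### Models of T(A; R) over the point, the interval and the square -/

namespace CochainAction

open MonoidalCategory CartesianMonoidalCategory

variable {E : DGOperad} {θ : CochainAction E} {A : E.Alg} {S : Type} [CommRing S]
  {R : Type} [CommRing R]

lemma isWeakEquivalence_toMapping_point {φ : R →+* S} (hφ : Function.Injective φ)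
    (hr : φ.range = ⊤) :
    IsWeakEquivalence (toMapping φ (fun _ => le_top) :
      (θ.T A).obj _ ⟶ θ.mapping A Δ[0] (.const Δ[0] ⊤)) :=
  isWeakEquivalence_toMapping hφ (SSet.stdSimplex.obj₀Equiv.symm 0) (fun _ => hr.symm)
    (fst _ _) (fun _ => le_rfl) (SSet.stdSimplex.isTerminalObj₀.hom_ext _ _) rfl _

lemma range_le_interval {φ : R →+* S} {Q : Subring S} (hr : φ.range ≤ Q)
    {n : SimplexCategoryᵒᵖ} (s : (Δ[1] : SSet.{0}).obj n) :
    φ.range ≤ (RingCoeff.interval Q).val s := by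
  by_cases hs : s ∈ (endpoint 0).obj n
  · rw [RingCoeff.interval_of_mem Q hs]
    exact hr
  · rw [RingCoeff.interval_of_notMem Q hs]
    exact le_top

lemma isWeakEquivalence_toMapping_interval {φ : R →+* S} (hφ : Function.Injective φ)
    {Q : Subring S} (hr : φ.range = Q) :
    IsWeakEquivalence (toMapping φ (range_le_interval hr.le) :
      (θ.T A).obj _ ⟶ θ.mapping A Δ[1] (.interval Q)) := by
  refine isWeakEquivalence_toMapping hφ (SSet.stdSimplex.obj₀Equiv.symm 0) (fun k => ?_)
    minMap (fun y => RingCoeff.interval_minMap_le Q y.1 y.2) ?_ ?_ _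
  · rw [hr]
    exact RingCoeff.interval_vertex_zero Q k
  · ext n s
    exact minMap_zero s s
  · ext n s
    exact minMap_one s s

lemma range_le_square {φ : R →+* S} {P Q : Subring S} (hr : φ.range = P ⊓ Q)
    {n : SimplexCategoryᵒᵖ} (y : (Δ[1] ⊗ Δ[1] : SSet.{0}).obj n) :
    φ.range ≤ (RingCoeff.square P Q).val y :=
  le_inf (range_le_interval (hr.le.trans inf_le_left) y.1)
    (range_le_interval (hr.le.trans inf_le_right) y.2)

lemma isWeakEquivalence_toMapping_square {φ : R →+* S} (hφ : Function.Injective φ)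
    {P Q : Subring S} (hr : φ.range = P ⊓ Q) :
    IsWeakEquivalence (toMapping φ (range_le_square hr) :
      (θ.T A).obj _ ⟶ θ.mapping A (Δ[1] ⊗ Δ[1]) (.square P Q)) := by
  refine isWeakEquivalence_toMapping hφ
    (SSet.stdSimplex.obj₀Equiv.symm 0, SSet.stdSimplex.obj₀Equiv.symm 0) (fun k => ?_)
    squareContraction (fun y => inf_le_inf (RingCoeff.interval_minMap_le P y.1.1 y.2)
      (RingCoeff.interval_minMap_le Q y.1.2 y.2)) ?_ ?_ _
  · rw [hr]
    exact congrArg₂ (· ⊓ ·) (RingCoeff.interval_vertex_zero P k)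
      (RingCoeff.interval_vertex_zero Q k)
  · refine CartesianMonoidalCategory.hom_ext _ _ ?_ ?_ <;> ext n s
    exacts [minMap_zero s.1 s, minMap_zero s.2 s]
  · refine CartesianMonoidalCategory.hom_ext _ _ ?_ ?_ <;> ext n s
    exacts [minMap_one s.1 s, minMap_one s.2 s]

lemma toMapping_evalOne {φ : R →+* S} {Q : Subring S} (hr : φ.range ≤ Q) :
    toMapping φ (range_le_interval hr) ≫ evalOne Q =
      (θ.T A).map (CommRingCat.ofHom φ) ≫ toMapping (RingHom.id S) (fun _ => le_top) := by
  ext n ψ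
  exact mapping_ext fun q a m y => rfl

variable {R' : Type} [CommRing R'] {P Q : Subring S}

lemma toMapping_squareFst {φ : R →+* S} (hr : φ.range = P ⊓ Q) {φ' : R' →+* S} (hr' : φ'.range ≤ P)
    {χ : R →+* R'} (hχ : φ = φ'.comp χ) :
    toMapping φ (range_le_square hr) ≫ squareFst P Q =
      (θ.T A).map (CommRingCat.ofHom χ) ≫ toMapping φ' (range_le_interval hr') := by
  subst hχ
  ext n ψ
  exact mapping_ext fun q a m y => rfl

lemma toMapping_squareSnd {φ : R →+* S} (hr : φ.range = P ⊓ Q) {φ' : R' →+* S} (hr' : φ'.range ≤ Q)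
    {χ : R →+* R'} (hχ : φ = φ'.comp χ) :
    toMapping φ (range_le_square hr) ≫ squareSnd P Q =
      (θ.T A).map (CommRingCat.ofHom χ) ≫ toMapping φ' (range_le_interval hr') := by
  subst hχ
  ext n ψ
  exact mapping_ext fun q a m y => rfl

end CochainAction

end

theorem mainTheorem4 (E : DGOperad) (hE : E.IsEInfinity) (hEc : E.IsCofibrant)
    (θ : CochainAction E) (A : E.Alg) (hA : A.IsCofibrant) :
    IsHomotopyCartesian ((θ.T A).map intToZHat) ((θ.T A).map intToRat)
      ((θ.T A).map zHatToQHat) ((θ.T A).map ratToQHat) := by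
  have w : intToZHat ≫ zHatToQHat = intToRat ≫ ratToQHat :=
    CommRingCat.hom_ext (RingHom.ext_int _ _)
  let P := zHatToQHat.hom.range
  let Q := ratToQHat.hom.range
  have hP : zHatToQHat.hom.range = P := rfl
  have hQ : ratToQHat.hom.range = Q := rfl
  have hZ : (Int.castRingHom QHat).range = P ⊓ Q := range_zHatToQHat_inf_range_ratToQHat.symm
  have hid : (RingHom.id QHat).range = ⊤ := RingHom.range_eq_top.2 Function.surjective_id
  -- The replacement of the cospan: path spaces over the interval with coefficients `P` and `Q` at
  -- the vertex `0`, evaluated at the vertex `1`.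
  refine ⟨by rw [← Functor.map_comp, ← Functor.map_comp, w], _, _, _,
    CochainAction.toMapping zHatToQHat.hom (CochainAction.range_le_interval hP.le),
    CochainAction.toMapping ratToQHat.hom (CochainAction.range_le_interval hQ.le),
    CochainAction.toMapping (RingHom.id QHat) (fun _ => le_top),
    CochainAction.evalOne P, CochainAction.evalOne Q,
    CochainAction.toMapping_evalOne hP.le,
    CochainAction.toMapping_evalOne hQ.le,
    CochainAction.isWeakEquivalence_toMapping_interval zHatToQHat_injective hP,
    CochainAction.isWeakEquivalence_toMapping_interval ratToQHat_injective hQ,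
    CochainAction.isWeakEquivalence_toMapping_point Function.injective_id hid,
    CochainAction.kanComplex_mapping hA ⊤, CochainAction.fibration_evalOne hA P,
    CochainAction.fibration_evalOne hA Q, ?_⟩
  -- The comparison map factors through the mapping space of the square: first the constant
  -- families, then restriction to the two edges. It agrees with this composite after both
  -- projections.
  have h := (CochainAction.isWeakEquivalence_toMapping_square (θ := θ) (A := A)
    intCast_qHat_injective hZ).comp (isWeakEquivalence_of_rlp
      (CochainAction.squareToPullback (θ := θ) (A := A) P Q)
      fun i _ => CochainAction.hasLiftingProperty_squareToPullback hA
        range_zHatToQHat_sup_range_ratToQHat i)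
  convert h using 1
  refine pullback.hom_ext ?_ ?_
  · rw [pullback.lift_fst, Category.assoc]
    refine Eq.trans ?_ (congrArg (_ ≫ ·) (pullback.lift_fst _ _ _)).symm
    exact (CochainAction.toMapping_squareFst hZ hP.le (RingHom.ext_int _ _)).symm
  · rw [pullback.lift_snd, Category.assoc]
    refine Eq.trans ?_ (congrArg (_ ≫ ·) (pullback.lift_snd _ _ _)).symm
    exact (CochainAction.toMapping_squareSnd hZ hQ.le (RingHom.ext_int _ _)).symm
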